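/- **Setting.** Let $g\ge 1$ and let $p_1=(a_1,b_1)$, $p_2=(a_2,b_2)$ be non-zero vectors of $\mathbb C^2$ with $[p_1]\ne[p_2]$ in $\mathbb CP^1$. Let $\mathcal P:\mathbb C^g\to\mathbb C^g$ be an invertible linear map with pairwise distinct eigenvalues $\lambda_1,\dots,\lambda_g$ and eigenvectors $v_1,\dots,v_g$, and let $$\Gamma=\mathbb CP^1\times\mathbb CP^{g-1}\big/\{([p_1],t)\sim([p_2],\mathcal P(t)),\ t\in\mathbb CP^{g-1}\}.$$ Fix $A,\Lambda,\tilde c_1,\dots,\tilde c_g\in\mathbb C^*$ and, for $1\le i\le g$, functions $F_i(z,t,s)=\sum_{k=1}^g(\gamma_{ik}(s)z_1+\delta_{ik}(s)z_2)t_k$ of $z=(z_1,z_2)\in\mathbb C^2$, $t\in\mathbb C^g$, $s\in\mathbb C$, with $\gamma_{ik},\delta_{ik}$ complex differentiable at $s=0$, such that $F_i(p_1,t,s)=Ae^{s}F_i(p_2,\mathcal P(t),s)$ for all $t,s$, and 1. $f(z,t):=F_i(z,t,0)$ does not depend on $i$; 2. $f,\partial_sF_1(\cdot,0),\dots,\partial_sF_g(\cdot,0)$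 are linearly independent; 3. $f(p_1,v_j)\ne0$ for all $j$. For $h=(h_1,\dots,h_g)\in(\mathbb C^*)^g$ put $f_i(z,t)=F_i(z,t,\tilde c_ih_i)$. Let $\mathcal K=\mathbb C(E)$ be the field of rational functions of $E=e^{\tilde c_1x_1+\dots+\tilde c_gx_g}$, where $x_1,\dots,x_g$ are complex variables. For $r\in\mathcal K$ let $\hat r:\mathbb Z^g\to\mathcal K$, $\hat r(n)=r(x+nh)$ with $nh=(n_1h_1,\dots,n_gh_g)$ (that is, $E$ is replaced by $e^{\sum_i\tilde c_in_ih_i}E$), and let $\hat{\mathcal K}=\{\hat r: r\in\mathcal K\}$. Let $\mathcal T_g=\hat{\mathcal K}[T_1,\dots,T_g]$ be the ring of difference operators, acting on functions of $n\in\mathbb Z^g$ with values in $\mathcal K(z_1,z_2,t_1,\dots,t_g)$, where $(T_i\psi)(n)=\psi(n+e_i)$. Let $\hat M_\Lambda=\bigcup_{k\ge0}\hat M_\Lambda(k)$, where $\hat M_\Lambda(k)$ consists of the functions $$\psi(n,z,t)=\frac{H(n,z,t)}{f(z,t)^k}\prod_{j=1}^g\Big(\frac{f_j(z,t)}{f(z,t)}\Big)^{n_j},\qquad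 H(n,z,t)=\sum_{0\le j\le k,\ |\alpha|=k}H_{j\alpha}(n)\,z_1^jz_2^{k-j}t^\alpha,\quad H_{j\alpha}\in\hat{\mathcal K},$$ with $\psi(n,p_1,t)=\Lambda E^{-1}\,\psi(n,p_2,\mathcal P(t))$ for all $n\in\mathbb Z^g$, identically in $t$. Finally, let $R$ be the ring of meromorphic functions on $\Gamma$ with poles only on the divisor $(f=0)$, that is, of rational functions on $\mathbb CP^1\times\mathbb CP^{g-1}$ that are regular where $f\ne0$ and whose values there are given by a function on $\Gamma$. **Statement.** The set of $h\in(\mathbb C^*)^g$ for which $\hat M_\Lambda$ is a free $\mathcal T_g$-module of rank $g$ with a basis $\psi_1,\dots,\psi_g$ in $\hat M_\Lambda(1)$ is uncountable. For every such $h$ and every such basis $\Psi={}^t(\psi_1,\dots,\psi_g)$ there is an injective homomorphism of $\mathbb C$-algebras $$D:R\longrightarrow \mathrm{Mat}(g,\mathcal T_g)\qquad\text{with}\qquad D(\varphi)\Psi=\varphi\Psi\quad\text{for all }\varphi\in R.$$ -/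

import Mathlib

noncomputable section

namespace RationalDBA

/-- Indices of the homogeneous coordinates `z₁, z₂` (left) and `t₁, …, t_g` (right) on
`ℂP¹ × ℂP^{g-1}`. -/
abbrev Coord (g : ℕ) : Type := Fin 2 ⊕ Fin g

/-- The bigrading: each `z` has bidegree `(1, 0)`, each `t` has bidegree `(0, 1)`. -/
def bideg (g : ℕ) : Coord g → ℕ × ℕ := Sum.elim (fun _ => (1, 0)) (fun _ => (0, 1))

/-- The polynomial `∑ₖ (αₖ z₁ + βₖ z₂) tₖ`. -/
def bilin {g : ℕ} (α β : Fin g → ℂ) : MvPolynomial (Coord g) ℂ :=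
  ∑ k, (MvPolynomial.C (α k) * MvPolynomial.X (Sum.inl 0) +
      MvPolynomial.C (β k) * MvPolynomial.X (Sum.inl 1)) * MvPolynomial.X (Sum.inr k)

/-- The data of the rational construction: the two hypersurfaces `{[p₁]} × ℂP^{g-1}` and
`{[p₂]} × ℂP^{g-1}`, the map `𝒫` that glues them, and the functions `f` and
`F_i(z, t, s) = ∑ₖ (γ_{ik}(s) z₁ + δ_{ik}(s) z₂) tₖ` with their constants. -/
structure Data (g : ℕ) where
  /-- `p₁ = (a₁, b₁)` -/
  p₁ : Fin 2 → ℂ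
  /-- `p₂ = (a₂, b₂)` -/
  p₂ : Fin 2 → ℂ
  p₁_ne : p₁ ≠ 0
  p₂_ne : p₂ ≠ 0
  p_ne : Projectivization.mk ℂ p₁ p₁_ne ≠ Projectivization.mk ℂ p₂ p₂_ne
  /-- the non-degenerate linear map `𝒫` -/
  P : (Fin g → ℂ) ≃ₗ[ℂ] (Fin g → ℂ)
  /-- the eigenvalues of `𝒫` -/
  eig : Fin g → ℂ
  /-- the eigenvectors of `𝒫` -/
  v : Fin g → Fin g → ℂ
  v_ne : ∀ j, v j ≠ 0
  P_v : ∀ j, P (v j) = eig j • v j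
  eig_injective : Function.Injective eig
  A : ℂ
  A_ne : A ≠ 0
  Lam : ℂ
  Lam_ne : Lam ≠ 0
  /-- the constants `c̃ᵢ` -/
  c : Fin g → ℂ
  c_ne : ∀ i, c i ≠ 0
  /-- the coefficients of `f = ∑ₖ (αₖ z₁ + βₖ z₂) tₖ` -/
  α : Fin g → ℂ
  β : Fin g → ℂ
  γ : Fin g → Fin g → ℂ → ℂ
  δ : Fin g → Fin g → ℂ → ℂ
  /-- `F_i(p₁, t, s) = A e^s F_i(p₂, 𝒫 t, s)` -/
  F_glue : ∀ (i : Fin g) (s : ℂ) (t : Fin g → ℂ),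
    MvPolynomial.eval (Sum.elim p₁ t) (bilin (fun k => γ i k s) (fun k => δ i k s)) =
      A * Complex.exp s *
        MvPolynomial.eval (Sum.elim p₂ (P t)) (bilin (fun k => γ i k s) (fun k => δ i k s))
  /-- `F_i(z, t, 0) = f(z, t)` for every `i` -/
  γ_zero : ∀ i k, γ i k 0 = α k
  δ_zero : ∀ i k, δ i k 0 = β k
  γ_diff : ∀ i k, DifferentiableAt ℂ (γ i k) 0
  δ_diff : ∀ i k, DifferentiableAt ℂ (δ i k) 0
  /-- `f, ∂ₛF₁(·, 0), …, ∂ₛF_g(·, 0)` are linearly independent -/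
  linInd : LinearIndependent ℂ (Fin.cons (bilin α β)
    (fun i => bilin (fun k => deriv (γ i k) 0) (fun k => deriv (δ i k) 0)) :
      Fin (g + 1) → MvPolynomial (Coord g) ℂ)
  f_v_ne : ∀ j, MvPolynomial.eval (Sum.elim p₁ (v j)) (bilin α β) ≠ 0

/-- A rational function `φ` on `ℂP¹ × ℂP^{g-1}` is regular at the point with homogeneous
coordinates `(z, t)`, with value `w` there. -/
def HasValueAt {g : ℕ} (φ : FractionRing (MvPolynomial (Coord g) ℂ))
    (z : Fin 2 → ℂ) (t : Fin g → ℂ) (w : ℂ) : Prop :=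
  ∃ (d : ℕ × ℕ) (p q : MvPolynomial (Coord g) ℂ),
    MvPolynomial.IsWeightedHomogeneous (bideg g) p d ∧
    MvPolynomial.IsWeightedHomogeneous (bideg g) q d ∧
    MvPolynomial.eval (Sum.elim z t) q ≠ 0 ∧
    φ = algebraMap _ _ p / algebraMap _ _ q ∧
    w = MvPolynomial.eval (Sum.elim z t) p / MvPolynomial.eval (Sum.elim z t) q

theorem algebraMap_ne {g : ℕ} {q : MvPolynomial (Coord g) ℂ} {x : Coord g → ℂ}
    (h : MvPolynomial.eval x q ≠ 0) :
    algebraMap (MvPolynomial (Coord g) ℂ) (FractionRing (MvPolynomial (Coord g) ℂ)) q ≠ 0 := by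
  intro h0
  apply h
  have : q = 0 := by
    apply IsFractionRing.injective (MvPolynomial (Coord g) ℂ)
      (FractionRing (MvPolynomial (Coord g) ℂ))
    rw [h0, map_zero]
  rw [this, map_zero]

theorem HasValueAt.mul {g : ℕ} {φ φ' : FractionRing (MvPolynomial (Coord g) ℂ)}
    {z : Fin 2 → ℂ} {t : Fin g → ℂ} {w w' : ℂ}
    (h : HasValueAt φ z t w) (h' : HasValueAt φ' z t w') :
    HasValueAt (φ * φ') z t (w * w') := by
  obtain ⟨d, p, q, hp, hq, hne, rfl, rfl⟩ := h
  obtain ⟨d', p', q', hp', hq', hne', rfl, rfl⟩ := h'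
  refine ⟨d + d', p * p', q * q', hp.mul hp', hq.mul hq', ?_, ?_, ?_⟩
  · rw [map_mul]; exact mul_ne_zero hne hne'
  · rw [map_mul, map_mul, div_mul_div_comm]
  · rw [map_mul, map_mul, div_mul_div_comm]

theorem HasValueAt.add {g : ℕ} {φ φ' : FractionRing (MvPolynomial (Coord g) ℂ)}
    {z : Fin 2 → ℂ} {t : Fin g → ℂ} {w w' : ℂ}
    (h : HasValueAt φ z t w) (h' : HasValueAt φ' z t w') :
    HasValueAt (φ + φ') z t (w + w') := by
  obtain ⟨d, p, q, hp, hq, hne, rfl, rfl⟩ := h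
  obtain ⟨d', p', q', hp', hq', hne', rfl, rfl⟩ := h'
  refine ⟨d + d', p * q' + q * p', q * q', (hp.mul hq').add (hq.mul hp'), hq.mul hq', ?_, ?_, ?_⟩
  · rw [map_mul]; exact mul_ne_zero hne hne'
  · rw [map_add, map_mul, map_mul, map_mul,
      div_add_div _ _ (algebraMap_ne hne) (algebraMap_ne hne')]
  · rw [map_add, map_mul, map_mul, map_mul, div_add_div _ _ hne hne']

theorem hasValueAt_const {g : ℕ} (r : ℂ) (z : Fin 2 → ℂ) (t : Fin g → ℂ) :
    HasValueAt (algebraMap ℂ (FractionRing (MvPolynomial (Coord g) ℂ)) r) z t r := by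
  refine ⟨0, MvPolynomial.C r, 1, MvPolynomial.isWeightedHomogeneous_C _ _,
    MvPolynomial.isWeightedHomogeneous_one _ _, by simp, ?_, by simp⟩
  rw [map_one, div_one, IsScalarTower.algebraMap_apply ℂ (MvPolynomial (Coord g) ℂ)]
  rfl

/-- The field of rational functions of `e^{c̃₁x₁ + ⋯ + c̃_g x_g}`; this exponential is
transcendental over `ℂ` and is represented by the variable `E = RatFunc.X`. -/
abbrev K : Type := RatFunc ℂ

/-- The field of rational functions in `z₁, z₂, t₁, …, t_g` with coefficients in `K`. -/
abbrev Phi (g : ℕ) : Type := FractionRing (MvPolynomial (Coord g) K)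

/-- Functions `ψ(n, P)` of the discrete variable `n ∈ ℤ^g`. -/
abbrev DFun (g : ℕ) : Type := (Fin g → ℤ) → Phi g

theorem toPhi_injective (g : ℕ) : Function.Injective
    ((algebraMap (MvPolynomial (Coord g) K) (Phi g)).comp
      (MvPolynomial.map (algebraMap ℂ K))) := by
  rw [RingHom.coe_comp]
  exact (IsFractionRing.injective (MvPolynomial (Coord g) K) (Phi g)).comp
    (MvPolynomial.map_injective _ (algebraMap ℂ K).injective)

/-- The inclusion `ℂ(z, t) ⊂ K(z, t)`. -/
def toPhi (g : ℕ) : FractionRing (MvPolynomial (Coord g) ℂ) →+* Phi g :=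
  IsFractionRing.lift (toPhi_injective g)

namespace Data

variable {g : ℕ} (S : Data g)

/-- The variety `Γ`, as a set: `ℂP¹ × ℂP^{g-1}` with `([p₁], t)` and `([p₂], 𝒫 t)` identified. -/
def Gam : Type :=
  Quot fun x y : Projectivization ℂ (Fin 2 → ℂ) × Projectivization ℂ (Fin g → ℂ) =>
    ∃ t : Projectivization ℂ (Fin g → ℂ),
      x = (Projectivization.mk ℂ S.p₁ S.p₁_ne, t) ∧
      y = (Projectivization.mk ℂ S.p₂ S.p₂_ne,
        Projectivization.map S.P.toLinearMap S.P.injective t)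

/-- The point of `Γ` with homogeneous coordinates `(z, t)`. -/
def pt (z : Fin 2 → ℂ) (hz : z ≠ 0) (t : Fin g → ℂ) (ht : t ≠ 0) : S.Gam :=
  Quot.mk _ (Projectivization.mk ℂ z hz, Projectivization.mk ℂ t ht)

/-- `f` -/
def f : MvPolynomial (Coord g) ℂ := bilin S.α S.β

/-- `f_i(P) = F_i(P, c̃ᵢ hᵢ)` -/
def fi (h : Fin g → ℂ) (i : Fin g) : MvPolynomial (Coord g) ℂ :=
  bilin (fun k => S.γ i k (S.c i * h i)) (fun k => S.δ i k (S.c i * h i))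

/-- The ring of meromorphic functions on `Γ` with poles only on `(f = 0)`: rational functions on
`ℂP¹ × ℂP^{g-1}` that are regular wherever `f ≠ 0` and whose values there are given by a function
`u` on `Γ`. -/
def merRing : Subalgebra ℂ (FractionRing (MvPolynomial (Coord g) ℂ)) where
  carrier := {φ | ∃ u : S.Gam → ℂ, ∀ (z : Fin 2 → ℂ) (hz : z ≠ 0) (t : Fin g → ℂ) (ht : t ≠ 0),
    MvPolynomial.eval (Sum.elim z t) S.f ≠ 0 → HasValueAt φ z t (u (S.pt z hz t ht))}
  mul_mem' := by
    rintro φ φ' ⟨u, hu⟩ ⟨u', hu'⟩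
    exact ⟨fun x => u x * u' x, fun z hz t ht hf => (hu z hz t ht hf).mul (hu' z hz t ht hf)⟩
  add_mem' := by
    rintro φ φ' ⟨u, hu⟩ ⟨u', hu'⟩
    exact ⟨fun x => u x + u' x, fun z hz t ht hf => (hu z hz t ht hf).add (hu' z hz t ht hf)⟩
  algebraMap_mem' r := ⟨fun _ => r, fun z _ t _ _ => hasValueAt_const r z t⟩

/-- The discretization `n ↦ r(x + nh)` of `r ∈ K`: the shift of `x` by
`nh = (n₁h₁, …, n_g h_g)` replaces `E` by `e^{∑ c̃ᵢ nᵢ hᵢ} E`. -/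
def hat (h : Fin g → ℂ) (r : K) : (Fin g → ℤ) → K := fun n =>
  r.eval (algebraMap ℂ K)
    (algebraMap ℂ K (Complex.exp (∑ i, S.c i * (n i : ℂ) * h i)) * RatFunc.X)

/-- Discrete functions (the ring of coefficients of difference operators). -/
def Khat (h : Fin g → ℂ) : Set ((Fin g → ℤ) → K) := Set.range (S.hat h)

/-- The operator of multiplication by a function `r` of `n`. -/
def mulOp (r : (Fin g → ℤ) → K) : Module.End ℂ (DFun g) :=
  LinearMap.mulLeft ℂ (fun n => algebraMap K (Phi g) (r n))

/-- The shift operator `(Tᵢ ψ)(n) = ψ(n + eᵢ)`. -/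
def shift (i : Fin g) : Module.End ℂ (DFun g) :=
  LinearMap.funLeft ℂ (Phi g) (fun n => n + Pi.single i 1)

/-- The ring of difference operators in `T₁, …, T_g` with coefficients in `Khat`, acting on
functions of `n`. -/
def T (h : Fin g → ℂ) : Subalgebra ℂ (Module.End ℂ (DFun g)) :=
  Algebra.adjoin ℂ (mulOp '' S.Khat h ∪ Set.range shift)

/-- The expression `H / f^k ∏ⱼ (f_j / f)^{n_j}`, evaluated in a field along `ρ`. -/
def expr {L : Type} [Field L] (ρ : MvPolynomial (Coord g) K →+* L) (h : Fin g → ℂ) (k : ℕ)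
    (n : Fin g → ℤ) (H : MvPolynomial (Coord g) K) : L :=
  ρ H / ρ (MvPolynomial.map (algebraMap ℂ K) S.f) ^ k *
    ∏ j, (ρ (MvPolynomial.map (algebraMap ℂ K) (S.fi h j)) /
      ρ (MvPolynomial.map (algebraMap ℂ K) S.f)) ^ n j

/-- The substitution `(z, t) := (p₁, t)`. -/
def res₁ : MvPolynomial (Coord g) K →+* FractionRing (MvPolynomial (Fin g) K) :=
  (algebraMap (MvPolynomial (Fin g) K) (FractionRing (MvPolynomial (Fin g) K))).comp
    (MvPolynomial.aeval (R := K) (Sum.elim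
      (fun a => MvPolynomial.C (algebraMap ℂ K (S.p₁ a)))
      (fun i => MvPolynomial.X i))).toRingHom

/-- The substitution `(z, t) := (p₂, 𝒫 t)`. -/
def res₂ : MvPolynomial (Coord g) K →+* FractionRing (MvPolynomial (Fin g) K) :=
  (algebraMap (MvPolynomial (Fin g) K) (FractionRing (MvPolynomial (Fin g) K))).comp
    (MvPolynomial.aeval (R := K) (Sum.elim
      (fun a => MvPolynomial.C (algebraMap ℂ K (S.p₂ a)))
      (fun i => ∑ j, MvPolynomial.C (algebraMap ℂ K (S.P (Pi.single j 1) i)) *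
        MvPolynomial.X j))).toRingHom

/-- The `k`-th piece of the discrete Baker-Akhiezer module: functions
`ψ(n, P) = H(n, P) / f(P)^k ∏ⱼ (f_j(P) / f(P))^{n_j}`, with `H(n, ·)` of bidegree `(k, k)` and
coefficients in `Khat`, such that `ψ(n, p₁, t) = Λ E⁻¹ ψ(n, p₂, 𝒫 t)`. -/
def Mhat (h : Fin g → ℂ) (k : ℕ) : Set (DFun g) :=
  {ψ | ∃ H : (Fin g → ℤ) → MvPolynomial (Coord g) K,
    (∀ n, MvPolynomial.IsWeightedHomogeneous (bideg g) (H n) (k, k)) ∧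
    (∀ m, (fun n => MvPolynomial.coeff m (H n)) ∈ S.Khat h) ∧
    (∀ n, ψ n = S.expr (algebraMap (MvPolynomial (Coord g) K) (Phi g)) h k n (H n)) ∧
    ∀ n, S.expr S.res₁ h k n (H n) =
      algebraMap K (FractionRing (MvPolynomial (Fin g) K))
        (algebraMap ℂ K S.Lam * RatFunc.X⁻¹) * S.expr S.res₂ h k n (H n)}

/-- `Ψ₁, …, Ψ_g` lie in the first piece of the discrete Baker-Akhiezer module `⋃ₖ Mhat(k)`, and
this module is a free module over the ring of difference operators with basis `Ψ₁, …, Ψ_g`. -/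
def IsFreeBasis (h : Fin g → ℂ) (Ψ : Fin g → DFun g) : Prop :=
  (∀ i, Ψ i ∈ S.Mhat h 1) ∧ LinearIndependent (S.T h) Ψ ∧
    (Submodule.span (S.T h) (Set.range Ψ) : Set (DFun g)) = ⋃ k, S.Mhat h k

end Data

end RationalDBA

end

/-! ### Meromorphic functions on `Γ` as quotients of glued forms -/

noncomputable section

namespace RationalDBA

open MvPolynomial

section Homogeneous

/-! The homomorphism. By the Nullstellensatz an element of `R` is `p / f ^ N` with `p` a form of
bidegree `(N, N)`, and `p` satisfies the gluing condition with multiplier `A ^ N`, as `f ^ N` does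
(`exists_of_mem_merRing`). Multiplication by it therefore preserves the Baker-Akhiezer module. It
does not involve `n`, so it commutes with difference operators; expanding `φ Ψ` in the basis gives
`D(φ)`, uniqueness of coordinates makes `D` an algebra homomorphism, and `D` is injective because
`φ` acts on functions with values in a field (`exists_algHom`).

The free bases. It is enough to treat the `h` for which all `c̃ᵢ hᵢ` equal one number `x`, with `x ≠
0` small. A function of the module is determined by its numerator at `n = 0`, which runs over the
space `W(k)` of forms of bidegree `(k, k)` glued with multiplier `A ^ k Λ E⁻¹`. On numerators `T_i`
is multiplication by `F_i(·, x)` combined with `E ↦ e^x E`, and the inclusion of level `k` in level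
`k + 1` is multiplication by `f`. All these maps send `W(k)` to `W(k + 1)`.

Freeness is then a spanning statement and a count. Spanning: the forms `f, F_1(·, x), …, F_g(·, x)`
generate all forms of bidegree `(2, 2)` for small `x ≠ 0`, since `f, ∂ₛF_1, …, ∂ₛF_g` do so in the
limit (`form_mul_eigForm_mem`, `eventually_generate`); the coefficients can be corrected to satisfy
the gluing condition because the syzygies of linear forms are Koszul (`exists_koszul`,
`exists_sum_mul_of_mem_W`). Hence words of length `k` in the `g + 1` operators, applied to a basis
of `W(1)`, span `W(k + 1)`. Count: `dim W(k + 1) = (k + 1) C(g + k, k + 1) = g C(g + k, k)` is the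
number of these words times `g = dim W(1)`, so they are also independent
(`linearIndependent_opPow`). -/

theorem isWeightedHomogeneous_of_mul {σ R M : Type*} [CommRing R] [IsDomain R]
    [AddCancelCommMonoid M] {w : σ → M} {p q : MvPolynomial σ R} {m n : M}
    (hq : IsWeightedHomogeneous w q n) (hq0 : q ≠ 0)
    (h : IsWeightedHomogeneous w (p * q) (m + n)) : IsWeightedHomogeneous w p m := by
  classical
  -- Only the component of `p` in degree `m` can contribute to the component of `p * q` in degree `m
  -- + n`, by cancellation in `M`.
  have key : weightedHomogeneousComponent w m p * q = p * q := by
    have h1 := h.weightedHomogeneousComponent_same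
    rw [← finsum_weightedHomogeneousComponent w p,
      finsum_eq_sum _ (weightedHomogeneousComponent_finsupp p), Finset.sum_mul, map_sum] at h1
    have h2 : ∀ d, weightedHomogeneousComponent w (m + n)
        (weightedHomogeneousComponent w d p * q) =
        if d = m then weightedHomogeneousComponent w d p * q else 0 := by
      intro d
      have h3 := (weightedHomogeneousComponent_isWeightedHomogeneous d p (w := w)).mul hq
      split_ifs with hd
      · subst hd; exact h3.weightedHomogeneousComponent_same
      · exact h3.weightedHomogeneousComponent_ne _ (fun h => hd (add_right_cancel h).symm)
    simp only [h2, Finset.sum_ite_eq'] at h1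
    have h4 : ∑ i ∈ (weightedHomogeneousComponent_finsupp (w := w) p).toFinset,
        weightedHomogeneousComponent w i p = p := by
      rw [← finsum_eq_sum, finsum_weightedHomogeneousComponent]
    rw [← Finset.sum_mul, h4] at h1
    rw [← h1]
    split_ifs with h5
    · rfl
    · have h6 := mt (Set.Finite.mem_toFinset (weightedHomogeneousComponent_finsupp p)).mpr h5
      rw [Function.mem_support, not_not] at h6
      rw [h6, zero_mul]
  rw [← mul_right_cancel₀ hq0 key]
  exact weightedHomogeneousComponent_isWeightedHomogeneous m p

end Homogeneous

theorem bilin_isWeightedHomogeneous {g : ℕ} (a b : Fin g → ℂ) :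
    IsWeightedHomogeneous (bideg g) (bilin a b) (1, 1) := by
  refine IsWeightedHomogeneous.sum _ _ _ fun k _ => ?_
  have h0 : ∀ (c : ℂ) (i : Fin 2),
      IsWeightedHomogeneous (bideg g) (C c * X (Sum.inl i)) (1, 0) := by
    intro c i
    have := (isWeightedHomogeneous_C (R := ℂ) (bideg g) c).mul
      (isWeightedHomogeneous_X ℂ (bideg g) (Sum.inl i))
    simpa [bideg] using this
  have := ((h0 (a k) 0).add (h0 (b k) 1)).mul (isWeightedHomogeneous_X ℂ (bideg g) (Sum.inr k))
  simpa [bideg] using this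

theorem eval_bilin {g : ℕ} (a b : Fin g → ℂ) (z : Fin 2 → ℂ) (t : Fin g → ℂ) :
    eval (Sum.elim z t) (bilin a b) = ∑ k, (a k * z 0 + b k * z 1) * t k := by
  simp [bilin]

/-- The denominators of `φ` form an ideal. Wherever `f ≠ 0` some denominator does not vanish, so `f`
vanishes on the zero locus of this ideal and a power of `f` belongs to it. -/
theorem exists_eq_div_pow {g : ℕ} {f : MvPolynomial (Coord g) ℂ}
    (hf0 : f ≠ 0) (hf : IsWeightedHomogeneous (bideg g) f (1, 1))
    {φ : FractionRing (MvPolynomial (Coord g) ℂ)}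
    (hφ : ∀ z : Fin 2 → ℂ, ∀ t : Fin g → ℂ, eval (Sum.elim z t) f ≠ 0 →
      ∃ w, HasValueAt φ z t w) :
    ∃ (N : ℕ) (p : MvPolynomial (Coord g) ℂ), IsWeightedHomogeneous (bideg g) p (N, N) ∧
      φ * algebraMap _ _ (f ^ N) = algebraMap _ _ p := by
  classical
  let I : Ideal (MvPolynomial (Coord g) ℂ) :=
    { carrier := {q | ∃ p : MvPolynomial (Coord g) ℂ, φ * algebraMap _ _ q = algebraMap _ _ p}
      zero_mem' := ⟨0, by simp⟩
      add_mem' := by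
        rintro a b ⟨p, hp⟩ ⟨p', hp'⟩
        exact ⟨p + p', by rw [map_add, mul_add, hp, hp', map_add]⟩
      smul_mem' := by
        rintro c a ⟨p, hp⟩
        exact ⟨c * p, by rw [smul_eq_mul, map_mul, mul_left_comm, hp, map_mul]⟩ }
  have hz : f ∈ vanishingIdeal ℂ (zeroLocus ℂ I) := by
    rw [mem_vanishingIdeal_iff]
    intro x hx
    by_contra hne
    rw [aeval_eq_eval] at hne
    have hx' : x = Sum.elim (fun a => x (Sum.inl a)) (fun a => x (Sum.inr a)) := by
      ext a; cases a <;> rfl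
    obtain ⟨w, d, p, q, -, -, hq, hpq, -⟩ := hφ (fun a => x (Sum.inl a)) (fun a => x (Sum.inr a))
      (by rw [← hx']; exact hne)
    have hqI : q ∈ I := ⟨p, by rw [hpq, div_mul_cancel₀ _ (algebraMap_ne hq)]⟩
    apply hq
    have := hx q hqI
    rwa [aeval_eq_eval, hx'] at this
  rw [vanishingIdeal_zeroLocus_eq_radical] at hz
  obtain ⟨N, p, hp⟩ := hz
  refine ⟨N, p, ?_, hp⟩
  have hx : ∃ x, eval x f ≠ 0 := by
    by_contra! h
    exact hf0 (MvPolynomial.funext fun x => by rw [h x, map_zero])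
  obtain ⟨x, hx⟩ := hx
  have hx' : x = Sum.elim (fun a => x (Sum.inl a)) (fun a => x (Sum.inr a)) := by
    ext a; cases a <;> rfl
  obtain ⟨w, d, p', q', hp', hq', hne, hpq, -⟩ :=
    hφ (fun a => x (Sum.inl a)) (fun a => x (Sum.inr a)) (by rw [← hx']; exact hx)
  have hq0 : q' ≠ 0 := by rintro rfl; simp at hne
  -- A local presentation `φ = p' / q'` by forms of equal bidegree gives `p q' = f ^ N p'`, so `p`
  -- is a quotient of two bihomogeneous forms.
  refine isWeightedHomogeneous_of_mul hq' hq0 ?_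
  have e : p * q' = f ^ N * p' := by
    apply IsFractionRing.injective (MvPolynomial (Coord g) ℂ)
      (FractionRing (MvPolynomial (Coord g) ℂ))
    rw [map_mul, ← hp, hpq, map_mul]
    field_simp [algebraMap_ne hne]
  rw [e]
  have := (hf.pow N).mul hp'
  simpa using this

namespace Data

variable {g : ℕ} (S : Data g)

/-- The substitution `(z, t) := (p₁, t)` over an extension of `ℂ`. -/
def rest₁ (F : Type) [Field F] [Algebra ℂ F] :
    MvPolynomial (Coord g) F →ₐ[F] MvPolynomial (Fin g) F :=
  aeval (Sum.elim (fun a => C (algebraMap ℂ F (S.p₁ a))) (fun i => X i))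

/-- The substitution `(z, t) := (p₂, 𝒫 t)` over an extension of `ℂ`. -/
def rest₂ (F : Type) [Field F] [Algebra ℂ F] :
    MvPolynomial (Coord g) F →ₐ[F] MvPolynomial (Fin g) F :=
  aeval (Sum.elim (fun a => C (algebraMap ℂ F (S.p₂ a)))
    (fun i => ∑ j, C (algebraMap ℂ F (S.P (Pi.single j 1) i)) * X j))

theorem res₁_apply (p : MvPolynomial (Coord g) K) :
    S.res₁ p = algebraMap _ (FractionRing (MvPolynomial (Fin g) K)) (S.rest₁ K p) := rfl

theorem res₂_apply (p : MvPolynomial (Coord g) K) :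
    S.res₂ p = algebraMap _ (FractionRing (MvPolynomial (Fin g) K)) (S.rest₂ K p) := rfl

theorem eval_rest₁ (t : Fin g → ℂ) (p : MvPolynomial (Coord g) ℂ) :
    eval t (S.rest₁ ℂ p) = eval (Sum.elim S.p₁ t) p := by
  have : (aeval t).comp (S.rest₁ ℂ) = aeval (R := ℂ) (Sum.elim S.p₁ t) := by
    ext i; rcases i with i | i <;> simp [rest₁]
  simpa [aeval_eq_eval] using DFunLike.congr_fun this p

theorem P_apply (t : Fin g → ℂ) (i : Fin g) : S.P t i = ∑ j, S.P (Pi.single j 1) i * t j := by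
  conv_lhs => rw [pi_eq_sum_univ' t]
  simp [map_sum, mul_comm]

theorem eval_rest₂ (t : Fin g → ℂ) (p : MvPolynomial (Coord g) ℂ) :
    eval t (S.rest₂ ℂ p) = eval (Sum.elim S.p₂ (S.P t)) p := by
  have : (aeval t).comp (S.rest₂ ℂ) = aeval (R := ℂ) (Sum.elim S.p₂ (S.P t)) := by
    ext i; rcases i with i | i
    · simp [rest₂]
    · simp [rest₂, S.P_apply t]
  simpa [aeval_eq_eval] using DFunLike.congr_fun this p

theorem map_rest₁ {F F' : Type} [Field F] [Algebra ℂ F] [Field F'] [Algebra ℂ F'] (σ : F →ₐ[ℂ] F')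
    (p : MvPolynomial (Coord g) F) :
    map (σ : F →+* F') (S.rest₁ F p) = S.rest₁ F' (map (σ : F →+* F') p) := by
  have : (map (σ : F →+* F')).comp (S.rest₁ F).toRingHom =
      (S.rest₁ F').toRingHom.comp (map (σ : F →+* F')) := by
    ext i
    · simp [rest₁]
    · rcases i with i | i <;> simp [rest₁]
  exact DFunLike.congr_fun this p

theorem map_rest₂ {F F' : Type} [Field F] [Algebra ℂ F] [Field F'] [Algebra ℂ F'] (σ : F →ₐ[ℂ] F')
    (p : MvPolynomial (Coord g) F) :
    map (σ : F →+* F') (S.rest₂ F p) = S.rest₂ F' (map (σ : F →+* F') p) := by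
  have : (map (σ : F →+* F')).comp (S.rest₂ F).toRingHom =
      (S.rest₂ F').toRingHom.comp (map (σ : F →+* F')) := by
    ext i
    · simp [rest₂]
    · rcases i with i | i <;> simp [rest₂]
  exact DFunLike.congr_fun this p

theorem map_rest₁_complex {F : Type} [Field F] [Algebra ℂ F] (p : MvPolynomial (Coord g) ℂ) :
    map (algebraMap ℂ F) (S.rest₁ ℂ p) = S.rest₁ F (map (algebraMap ℂ F) p) :=
  S.map_rest₁ (Algebra.ofId ℂ F) p

theorem map_rest₂_complex {F : Type} [Field F] [Algebra ℂ F] (p : MvPolynomial (Coord g) ℂ) :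
    map (algebraMap ℂ F) (S.rest₂ ℂ p) = S.rest₂ F (map (algebraMap ℂ F) p) :=
  S.map_rest₂ (Algebra.ofId ℂ F) p

theorem f_ne : S.f ≠ 0 := by
  have := S.linInd.ne_zero 0
  simpa [f] using this

theorem f_isWeightedHomogeneous : IsWeightedHomogeneous (bideg g) S.f (1, 1) :=
  bilin_isWeightedHomogeneous _ _

/-- `F_i(z, t, s)` -/
def F (i : Fin g) (s : ℂ) : MvPolynomial (Coord g) ℂ :=
  bilin (fun k => S.γ i k s) (fun k => S.δ i k s)

theorem F_zero (i : Fin g) : S.F i 0 = S.f := by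
  simp [F, f, S.γ_zero, S.δ_zero]

theorem fi_eq (h : Fin g → ℂ) (i : Fin g) : S.fi h i = S.F i (S.c i * h i) := rfl

theorem rest₁_F (i : Fin g) (s : ℂ) :
    S.rest₁ ℂ (S.F i s) = C (S.A * Complex.exp s) * S.rest₂ ℂ (S.F i s) := by
  apply MvPolynomial.funext
  intro t
  rw [map_mul, eval_C, eval_rest₁, eval_rest₂]
  exact S.F_glue i s t

theorem f_glue (t : Fin g → ℂ) :
    eval (Sum.elim S.p₁ t) S.f = S.A * eval (Sum.elim S.p₂ (S.P t)) S.f := by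
  rcases g with _ | g
  -- For `g = 0` there is no `F_i` to specialize at `s = 0`, but then `f = 0`.
  · simp [f, bilin]
  · have := S.F_glue 0 0 t
    simpa [S.γ_zero, S.δ_zero, f] using this

theorem rest₁_f : S.rest₁ ℂ S.f = C S.A * S.rest₂ ℂ S.f := by
  apply MvPolynomial.funext
  intro t
  rw [map_mul, eval_C, eval_rest₁, eval_rest₂, f_glue]

theorem rest₁_f_ne (hg : 1 ≤ g) : S.rest₁ ℂ S.f ≠ 0 := by
  intro h
  have := S.f_v_ne ⟨0, hg⟩
  apply this
  change eval _ S.f = 0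
  rw [← eval_rest₁, h, map_zero]

theorem pt_glue (t : Fin g → ℂ) (ht : t ≠ 0) :
    S.pt S.p₁ S.p₁_ne t ht =
      S.pt S.p₂ S.p₂_ne (S.P t) (by simpa using ht) :=
  Quot.sound ⟨Projectivization.mk ℂ t ht, rfl, by rw [Projectivization.map_mk]; rfl⟩

theorem eval_mul_of_hasValueAt {φ : FractionRing (MvPolynomial (Coord g) ℂ)}
    {p q : MvPolynomial (Coord g) ℂ} (hpq : φ * algebraMap _ _ q = algebraMap _ _ p)
    {z : Fin 2 → ℂ} {t : Fin g → ℂ} {w : ℂ} (hw : HasValueAt φ z t w) :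
    w * eval (Sum.elim z t) q = eval (Sum.elim z t) p := by
  obtain ⟨d, p', q', -, -, hne, rfl, rfl⟩ := hw
  have e : p' * q = p * q' := by
    apply IsFractionRing.injective (MvPolynomial (Coord g) ℂ)
      (FractionRing (MvPolynomial (Coord g) ℂ))
    rw [map_mul, map_mul, ← hpq]
    field_simp [algebraMap_ne hne]
  have := congrArg (eval (Sum.elim z t)) e
  rw [map_mul, map_mul] at this
  field_simp
  rw [this, mul_comm]

theorem exists_of_mem_merRing (hg : 1 ≤ g) {φ : FractionRing (MvPolynomial (Coord g) ℂ)}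
    (hφ : φ ∈ S.merRing) :
    ∃ (N : ℕ) (p : MvPolynomial (Coord g) ℂ), IsWeightedHomogeneous (bideg g) p (N, N) ∧
      φ * algebraMap _ _ (S.f ^ N) = algebraMap _ _ p ∧
      S.rest₁ ℂ p = C (S.A ^ N) * S.rest₂ ℂ p := by
  obtain ⟨u, hu⟩ := hφ
  have hev : ∀ (z : Fin 2 → ℂ) (t : Fin g → ℂ), eval (Sum.elim z t) S.f ≠ 0 → z ≠ 0 ∧ t ≠ 0 := by
    intro z t h
    constructor <;> (rintro rfl; apply h; rw [f, eval_bilin]; simp)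
  obtain ⟨N, p, hp, hφp⟩ := exists_eq_div_pow S.f_ne S.f_isWeightedHomogeneous (φ := φ)
    (fun z t h => ⟨_, hu z (hev z t h).1 t (hev z t h).2 h⟩)
  refine ⟨N, p, hp, hφp, ?_⟩
  -- The values of `φ` at glued points are comparable only where `f ≠ 0`; the extra factor `f(p₁,
  -- t)` makes the identity trivial at the other `t`.
  apply mul_left_cancel₀ (S.rest₁_f_ne hg)
  apply MvPolynomial.funext
  intro t
  simp only [map_mul, eval_C, eval_rest₁, eval_rest₂]
  by_cases h1 : eval (Sum.elim S.p₁ t) S.f = 0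
  · rw [h1]; ring
  · have h2 : eval (Sum.elim S.p₂ (S.P t)) S.f ≠ 0 := by
      intro h; apply h1; rw [f_glue, h, mul_zero]
    congr 1
    have e1 := eval_mul_of_hasValueAt hφp (hu _ S.p₁_ne t (hev _ _ h1).2 h1)
    have e2 := eval_mul_of_hasValueAt hφp (hu _ S.p₂_ne _ (hev _ _ h2).2 h2)
    rw [← e1, ← e2, S.pt_glue, map_pow, map_pow, f_glue]
    ring

end Data
end RationalDBA
end

/-! ### Scaling of `E`, and the homomorphism into matrices of difference operators -/

noncomputable section

namespace RationalDBA

open MvPolynomial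

section Scale

/-- Scaling by `q⁻¹` is the inverse on polynomials. Injectivity is what allows the scaling to extend
to rational functions. -/
theorem aeval_smul_X_injective {q : ℂ} (hq : q ≠ 0) : Function.Injective
    (Polynomial.aeval (R := ℂ) (algebraMap ℂ K q * RatFunc.X) : Polynomial ℂ →ₐ[ℂ] K) := by
  have h1 : (Polynomial.aeval (R := ℂ) (algebraMap ℂ K q * RatFunc.X) : Polynomial ℂ →ₐ[ℂ] K) =
      (Algebra.algHom ℂ (Polynomial ℂ) K).comp
        (Polynomial.aeval (R := ℂ) (Polynomial.C q * Polynomial.X)) := by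
    ext1
    simp only [AlgHom.comp_apply, Polynomial.aeval_X, map_mul, RatFunc.algebraMap_eq_C]
    exact (congrArg₂ _ (RatFunc.algebraMap_C q) RatFunc.algebraMap_X).symm
  rw [h1, AlgHom.coe_comp]
  refine (RatFunc.algebraMap_injective ℂ).comp ?_
  have h2 : Function.LeftInverse
      (Polynomial.aeval (R := ℂ) (Polynomial.C q⁻¹ * Polynomial.X : Polynomial ℂ))
      (Polynomial.aeval (R := ℂ) (Polynomial.C q * Polynomial.X : Polynomial ℂ)) := by
    intro p
    have : (Polynomial.aeval (R := ℂ) (Polynomial.C q⁻¹ * Polynomial.X : Polynomial ℂ)).comp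
        (Polynomial.aeval (R := ℂ) (Polynomial.C q * Polynomial.X : Polynomial ℂ)) =
        AlgHom.id ℂ _ := by
      ext1
      simp only [AlgHom.comp_apply, Polynomial.aeval_X, map_mul, AlgHom.id_apply]
      rw [← Polynomial.algebraMap_eq, AlgHom.commutes, Polynomial.algebraMap_eq, ← mul_assoc,
        ← map_mul, mul_inv_cancel₀ hq, map_one, one_mul]
    exact DFunLike.congr_fun this p
  exact h2.injective

/-- The substitution `E ↦ e^s E`. -/
def expScale (s : ℂ) : K →ₐ[ℂ] K :=
  RatFunc.liftAlgHom (Polynomial.aeval (algebraMap ℂ K (Complex.exp s) * RatFunc.X))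
    (nonZeroDivisors_le_comap_nonZeroDivisors_of_injective _
      (aeval_smul_X_injective (Complex.exp_ne_zero s)))

theorem expScale_eq_eval (s : ℂ) (r : K) : expScale s r =
    r.eval (algebraMap ℂ K) (algebraMap ℂ K (Complex.exp s) * RatFunc.X) :=
  RatFunc.liftAlgHom_apply _ _ r

theorem expScale_X (s : ℂ) :
    expScale s RatFunc.X = algebraMap ℂ K (Complex.exp s) * RatFunc.X := by
  rw [expScale_eq_eval, RatFunc.eval_X]

theorem algHom_K_ext {L : Type*} [Field L] [Algebra ℂ L] {σ τ : K →ₐ[ℂ] L}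
    (h : σ RatFunc.X = τ RatFunc.X) : σ = τ := by
  have : (σ : K →+* L) = τ := by
    apply IsLocalization.ringHom_ext (nonZeroDivisors (Polynomial ℂ))
    apply Polynomial.ringHom_ext
    · intro a
      change σ (algebraMap _ _ (Polynomial.C a)) = τ (algebraMap _ _ (Polynomial.C a))
      rw [RatFunc.algebraMap_C, ← RatFunc.algebraMap_eq_C, σ.commutes, τ.commutes]
    · simpa using h
  ext x
  exact DFunLike.congr_fun this x

theorem expScale_add (s s' : ℂ) : expScale (s + s') = (expScale s).comp (expScale s') := by
  apply algHom_K_ext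
  rw [AlgHom.comp_apply, expScale_X, expScale_X, map_mul, AlgHom.commutes, expScale_X,
    Complex.exp_add, map_mul]
  ring

theorem expScale_zero : expScale 0 = AlgHom.id ℂ K := by
  apply algHom_K_ext
  rw [expScale_X]
  simp

end Scale

namespace Data

variable {g : ℕ} (S : Data g)

/-- The exponent of the shift by `nh`. -/
def expo (h : Fin g → ℂ) (n : Fin g → ℤ) : ℂ := ∑ i, S.c i * (n i : ℂ) * h i

theorem hat_apply (h : Fin g → ℂ) (r : K) (n : Fin g → ℤ) :
    S.hat h r n = expScale (S.expo h n) r := (expScale_eq_eval _ _).symm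

theorem expo_add (h : Fin g → ℂ) (n m : Fin g → ℤ) :
    S.expo h (n + m) = S.expo h n + S.expo h m := by
  simp only [expo, ← Finset.sum_add_distrib, Pi.add_apply, Int.cast_add]
  exact Finset.sum_congr rfl fun i _ => by ring

theorem expo_zero (h : Fin g → ℂ) : S.expo h 0 = 0 := by simp [expo]

theorem expo_single (h : Fin g → ℂ) (i : Fin g) :
    S.expo h (Pi.single i 1) = S.c i * h i := by
  rw [expo, Finset.sum_eq_single i] <;> simp +contextual

theorem hat_mul (h : Fin g → ℂ) (r r' : K) : S.hat h (r * r') = S.hat h r * S.hat h r' := by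
  ext1 n; simp [hat_apply]

/-- An element of `Khat` is recovered from its value at `n = 0` by scaling `E`, so all the
dependence of a numerator on `n` is this scaling. -/
theorem mem_Khat_iff (h : Fin g → ℂ) (H : (Fin g → ℤ) → MvPolynomial (Coord g) K) :
    (∀ m, (fun n => coeff m (H n)) ∈ S.Khat h) ↔
      ∀ n, H n = map (expScale (S.expo h n) : K →+* K) (H 0) := by
  constructor
  · intro hH n
    ext m
    obtain ⟨r, hr⟩ := hH m
    have h0 := congrFun hr 0
    have hn := congrFun hr n
    rw [hat_apply] at h0 hn
    rw [expo_zero, expScale_zero, AlgHom.id_apply] at h0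
    rw [coeff_map, ← h0, ← hn]
    rfl
  · intro hH m
    refine ⟨coeff m (H 0), ?_⟩
    ext1 n
    rw [hat_apply, hH n, coeff_map]
    rfl

theorem expr_mul_mul {L : Type} [Field L] (ρ : MvPolynomial (Coord g) K →+* L) (h : Fin g → ℂ)
    (N k : ℕ) (n : Fin g → ℤ) (p H : MvPolynomial (Coord g) K) :
    S.expr ρ h (N + k) n (p * H) =
      ρ p / ρ (map (algebraMap ℂ K) S.f) ^ N * S.expr ρ h k n H := by
  rw [expr, expr, ← mul_assoc, map_mul, pow_add, div_mul_div_comm]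

theorem res_div_pow {N : ℕ} {p : MvPolynomial (Coord g) ℂ}
    (hp : S.rest₁ ℂ p = C (S.A ^ N) * S.rest₂ ℂ p) :
    S.res₁ (map (algebraMap ℂ K) p) / S.res₁ (map (algebraMap ℂ K) S.f) ^ N =
      S.res₂ (map (algebraMap ℂ K) p) / S.res₂ (map (algebraMap ℂ K) S.f) ^ N := by
  have h1 := congrArg (fun q => algebraMap _ (FractionRing (MvPolynomial (Fin g) K))
    (map (algebraMap ℂ K) q)) hp
  have h2 := congrArg (fun q => algebraMap _ (FractionRing (MvPolynomial (Fin g) K))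
    (map (algebraMap ℂ K) q)) S.rest₁_f
  simp only [map_rest₁_complex, map_rest₂_complex, map_mul, map_C, ← res₁_apply,
    ← res₂_apply] at h1 h2
  rw [h1, h2, mul_pow, ← map_pow, ← map_pow, ← map_pow]
  apply mul_div_mul_left
  rw [Ne, FaithfulSMul.algebraMap_eq_zero_iff, C_eq_zero]
  simp [S.A_ne]

theorem toPhi_algebraMap (p : MvPolynomial (Coord g) ℂ) :
    toPhi g (algebraMap _ _ p) = algebraMap _ (Phi g) (map (algebraMap ℂ K) p) :=
  IsFractionRing.lift_algebraMap (toPhi_injective g) p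

/-- With `φ = p / f ^ N`, the multipliers `A ^ N` of `p` and of `f ^ N` cancel, so the factor `Λ
E⁻¹` is unchanged while the level rises by `N`. -/
theorem mul_mem_iUnion_Mhat (hg : 1 ≤ g) (h : Fin g → ℂ)
    {φ : FractionRing (MvPolynomial (Coord g) ℂ)} (hφ : φ ∈ S.merRing) {k : ℕ} {ψ : DFun g}
    (hψ : ψ ∈ S.Mhat h k) : (fun n => toPhi g φ * ψ n) ∈ ⋃ k, S.Mhat h k := by
  obtain ⟨N, p, hp, hφp, hglue⟩ := S.exists_of_mem_merRing hg hφ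
  obtain ⟨H, hH, hK, hψ, hres⟩ := hψ
  rw [Set.mem_iUnion]
  refine ⟨N + k, fun n => map (algebraMap ℂ K) p * H n, fun n => ?_, ?_, fun n => ?_, fun n => ?_⟩
  · have : IsWeightedHomogeneous (bideg g) (map (algebraMap ℂ K) p) (N, N) := by
      intro d hd
      apply hp
      rintro h0
      apply hd
      rw [coeff_map, h0, map_zero]
    exact this.mul (hH n)
  · rw [mem_Khat_iff] at hK ⊢
    intro n
    rw [hK n, map_mul, map_map]
    congr 3
    ext x
    exact ((expScale (S.expo h n)).commutes x).symm
  · dsimp only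
    rw [expr_mul_mul, ← hψ]
    congr 1
    have hf : algebraMap (MvPolynomial (Coord g) ℂ) (FractionRing (MvPolynomial (Coord g) ℂ))
        (S.f ^ N) ≠ 0 := by
      rw [Ne, FaithfulSMul.algebraMap_eq_zero_iff]
      exact pow_ne_zero _ S.f_ne
    rw [eq_div_of_mul_eq hf hφp, map_div₀, toPhi_algebraMap, toPhi_algebraMap, map_pow, map_pow]
  · rw [expr_mul_mul, expr_mul_mul, S.res_div_pow hglue, hres]
    ring

theorem smul_const_mul (h : Fin g → ℂ) (D : S.T h) (c : Phi g) (ψ : DFun g) :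
    (D • fun n => c * ψ n) = fun n => c * (D • ψ) n := by
  obtain ⟨D, hD⟩ := D
  change D (fun n => c * ψ n) = fun n => c * D ψ n
  induction hD using Algebra.adjoin_induction generalizing ψ with
  | mem x hx =>
    rcases hx with ⟨r, -, rfl⟩ | ⟨i, rfl⟩
    · ext1 n
      change algebraMap K (Phi g) (r n) * (c * ψ n) = c * (algebraMap K (Phi g) (r n) * ψ n)
      ring
    · rfl
  | algebraMap r =>
    ext1 n
    exact (mul_smul_comm r c (ψ n)).symm
  | add x y _ _ hx hy =>
    rw [LinearMap.add_apply, LinearMap.add_apply, hx, hy]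
    ext1 n
    exact (mul_add _ _ _).symm
  | mul x y _ _ hx hy =>
    rw [Module.End.mul_apply, Module.End.mul_apply, hy, hx]

theorem exists_algHom (hg : 1 ≤ g) (h : Fin g → ℂ) (Ψ : Fin g → DFun g)
    (hΨ : S.IsFreeBasis h Ψ) :
    ∃ D : S.merRing →ₐ[ℂ] Matrix (Fin g) (Fin g) (S.T h),
      Function.Injective D ∧
      ∀ (φ : S.merRing) (i : Fin g),
        ∑ j, D φ i j • Ψ j = fun n => toPhi g (φ : FractionRing _) * Ψ i n := by
  obtain ⟨h1, hli, hspan⟩ := hΨ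
  have hinj : ∀ c d : Fin g → S.T h, ∑ j, c j • Ψ j = ∑ j, d j • Ψ j → c = d := by
    intro c d hcd
    exact Fintype.linearIndependent_iffₛ.mp hli c d hcd |> funext
  have hex : ∀ (φ : S.merRing) (i : Fin g), ∃ c : Fin g → S.T h,
      ∑ j, c j • Ψ j = fun n => toPhi g (φ : FractionRing _) * Ψ i n := by
    intro φ i
    rw [← Submodule.mem_span_range_iff_exists_fun, ← SetLike.mem_coe, hspan]
    exact S.mul_mem_iUnion_Mhat hg h φ.2 (h1 i)
  choose D hD using hex
  -- Every algebra law for `D` follows from this uniqueness: both sides have the same effect on `Ψ`.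
  have hM : ∀ (M : Matrix (Fin g) (Fin g) (S.T h)) (φ : S.merRing),
      (∀ i, ∑ j, M i j • Ψ j = fun n => toPhi g (φ : FractionRing _) * Ψ i n) →
      Matrix.of (D φ) = M := by
    intro M φ hMφ
    exact funext fun i => hinj _ _ ((hD φ i).trans (hMφ i).symm)
  refine ⟨AlgHom.ofLinearMap
    { toFun := fun φ => Matrix.of (D φ), map_add' := ?_, map_smul' := ?_ } ?_ ?_, ?_, hD⟩
  · intro φ φ'
    apply hM
    intro i
    simp only [Matrix.add_apply, Matrix.of_apply, add_smul, Finset.sum_add_distrib, hD]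
    ext1 n
    simp [add_mul]
  · intro c φ
    apply hM
    intro i
    have hs : ∀ (d : S.T h) (ψ : DFun g), (c • d) • ψ = c • d • ψ := fun _ _ => rfl
    simp only [Matrix.smul_apply, Matrix.of_apply, RingHom.id_apply, hs, ← Finset.smul_sum, hD]
    ext1 n
    have : toPhi g (algebraMap ℂ _ c) = algebraMap ℂ (Phi g) c := by
      rw [IsScalarTower.algebraMap_apply ℂ (MvPolynomial (Coord g) ℂ), toPhi_algebraMap,
        algebraMap_eq, map_C, IsScalarTower.algebraMap_apply ℂ K (Phi g),
        IsScalarTower.algebraMap_apply K (MvPolynomial (Coord g) K) (Phi g), algebraMap_eq]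
    rw [Pi.smul_apply, Subalgebra.coe_smul, Algebra.smul_def, Algebra.smul_def, map_mul, this,
      mul_assoc]
  · apply hM
    intro i
    simp [Matrix.one_apply, ite_smul]
  · intro φ φ'
    apply hM
    intro i
    simp only [LinearMap.coe_mk, AddHom.coe_mk, Matrix.mul_apply, Matrix.of_apply,
      Finset.sum_smul, mul_smul]
    rw [Finset.sum_comm]
    -- The function `φ'` is constant in `n`, so it moves out past the entries of `D φ`, which then
    -- act on `Ψ` alone.
    simp only [← Finset.smul_sum, hD, smul_const_mul]
    ext1 n
    have := congrFun (hD φ i) n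
    rw [Finset.sum_apply] at this ⊢
    rw [← Finset.mul_sum, this]
    simp only [MulMemClass.coe_mul, map_mul]
    ring
  · rw [injective_iff_map_eq_zero]
    intro φ hφ
    have h0 := hD φ ⟨0, hg⟩
    have hz : D φ ⟨0, hg⟩ = 0 := congrFun hφ ⟨0, hg⟩
    simp only [hz, Pi.zero_apply, zero_smul, Finset.sum_const_zero] at h0
    have hne := hli.ne_zero ⟨0, hg⟩
    obtain ⟨n, hn⟩ := Function.ne_iff.mp hne
    have := congrFun h0 n
    have h2 := (mul_eq_zero.mp this.symm).resolve_right hn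
    exact Subtype.ext ((map_eq_zero _).mp h2)

end Data
end RationalDBA
end

/-! ### Koszul syzygies of linear forms -/

noncomputable section

namespace RationalDBA

open MvPolynomial

section Koszul

variable {F σ ι : Type*} [Field F] [Fintype σ]

/-- The derivation `∑ₗ M_{lm} ∂ₗ`. -/
def linDer (M : Matrix σ ι F) (m : ι) : Derivation F (MvPolynomial σ F) (MvPolynomial σ F) :=
  ∑ l, M l m • pderiv l

theorem linDer_apply (M : Matrix σ ι F) (m : ι) (p : MvPolynomial σ F) :
    linDer M m p = ∑ l, C (M l m) * pderiv l p := by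
  have h := congrFun (map_sum (Derivation.coeFnAddMonoidHom (R := F) (A := MvPolynomial σ F)
    (M := MvPolynomial σ F)) (fun l => M l m • pderiv l) Finset.univ) p
  refine h.trans ?_
  rw [Finset.sum_apply]
  exact Finset.sum_congr rfl fun l _ => smul_eq_C_mul (pderiv l p) (M l m)

theorem linDer_isHomogeneous (M : Matrix σ ι F) (m : ι) {p : MvPolynomial σ F} {k : ℕ}
    (hp : p.IsHomogeneous k) : (linDer M m p).IsHomogeneous (k - 1) := by
  rw [linDer_apply]
  exact IsHomogeneous.sum _ _ _ fun l _ => hp.pderiv.C_mul _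

variable {N : Matrix ι σ F} {M : Matrix σ ι F} {l : ι → MvPolynomial σ F}

theorem linDer_linear (hl : ∀ i, l i = ∑ j, C (N i j) * X j) (i m : ι) :
    linDer M m (l i) = C ((N * M) i m) := by
  classical
  rw [linDer_apply, hl, Matrix.mul_apply, map_sum]
  refine Finset.sum_congr rfl fun j _ => ?_
  simp [pderiv_X, Pi.single_apply, mul_comm]

variable [Fintype ι]

/-- Euler's formula, written with the forms `l m` in place of the variables; `M * N = 1` expresses
each variable through the `l m`. -/
theorem sum_mul_linDer [DecidableEq σ] (hl : ∀ i, l i = ∑ j, C (N i j) * X j) (hMN : M * N = 1)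
    {p : MvPolynomial σ F} {k : ℕ} (hp : p.IsHomogeneous k) :
    ∑ m, l m * linDer M m p = k • p := by
  rw [← hp.sum_X_mul_pderiv]
  simp only [linDer_apply, hl, Finset.sum_mul, Finset.mul_sum]
  have h1 : ∀ a b : σ, ∑ m, C (N m b) * X b * (C (M a m) * pderiv a p) =
      if a = b then X b * pderiv a p else 0 := by
    intro a b
    have := congrArg (C (σ := σ)) (congrFun (congrFun hMN a) b)
    rw [Matrix.mul_apply, map_sum] at this
    rw [Finset.sum_congr rfl (g := fun m => C (M a m * N m b) * (X b * pderiv a p))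
      (fun m _ => by rw [map_mul]; ring), ← Finset.sum_mul, this, Matrix.one_apply]
    split_ifs <;> simp
  rw [Finset.sum_comm]
  rw [Finset.sum_congr rfl fun b _ => Finset.sum_comm]
  simp [h1]

/-- Differentiate the syzygy along `linDer M i` and use Euler's formula for `c i`. The last sum
comes from differentiating the forms themselves; it would be just `c i` if the `l i` were
independent. -/
theorem sum_mul_antisymm [DecidableEq σ] (hl : ∀ i, l i = ∑ j, C (N i j) * X j) (hMN : M * N = 1)
    {c : ι → MvPolynomial σ F} {k : ℕ} (hc : ∀ i, (c i).IsHomogeneous k)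
    (hsyz : ∑ i, l i * c i = 0) (i : ι) :
    ∑ m, l m * (linDer M m (c i) - linDer M i (c m)) =
      k • c i + ∑ m, C ((N * M) m i) * c m := by
  have h := congrArg (linDer M i) hsyz
  simp only [map_sum, map_zero, Derivation.leibniz, smul_eq_mul, linDer_linear hl,
    Finset.sum_add_distrib] at h
  simp only [mul_sub, Finset.sum_sub_distrib]
  rw [sum_mul_linDer hl hMN (hc i), eq_neg_of_add_eq_zero_left h, sub_neg_eq_add]
  simp only [mul_comm]

/-- In positive degree the syzygies of linear forms spanning all linear forms are Koszul. -/
theorem exists_koszul [CharZero F] [DecidableEq σ] (hl : ∀ i, l i = ∑ j, C (N i j) * X j)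
    (hMN : M * N = 1) {c : ι → MvPolynomial σ F} {k : ℕ} (hk : 1 ≤ k)
    (hc : ∀ i, (c i).IsHomogeneous k) (hsyz : ∑ i, l i * c i = 0) :
    ∃ w : ι → ι → MvPolynomial σ F, (∀ i j, (w i j).IsHomogeneous (k - 1)) ∧
      (∀ i j, w i j = -w j i) ∧ ∀ i, c i = ∑ j, l j * w i j := by
  have hk0 : (k : F) ≠ 0 := by exact_mod_cast (by omega : k ≠ 0)
  have hk1 : (k : F) + 1 ≠ 0 := by exact_mod_cast (by omega : k + 1 ≠ 0)
  have hidem : (N * M) * (N * M) = N * M := by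
    rw [Matrix.mul_assoc, ← Matrix.mul_assoc M N M, hMN, Matrix.one_mul]
  have hNl : ∀ m, ∑ i, C ((N * M) m i) * l i = l m := by
    intro m
    have h1 : ∀ j, ∑ i, (N * M) m i * N i j = N m j := by
      intro j
      rw [← Matrix.mul_apply, Matrix.mul_assoc, hMN, Matrix.mul_one]
    simp only [hl, Finset.mul_sum]
    rw [Finset.sum_comm]
    refine Finset.sum_congr rfl fun j _ => ?_
    rw [← h1 j, map_sum, Finset.sum_mul]
    exact Finset.sum_congr rfl fun i _ => by rw [map_mul]; ring
  set e : ι → MvPolynomial σ F := fun i => ∑ m, C ((N * M) m i) * c m with he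
  have hesyz : ∑ i, l i * e i = 0 := by
    simp only [he, Finset.mul_sum]
    rw [Finset.sum_comm, ← hsyz]
    refine Finset.sum_congr rfl fun m _ => ?_
    rw [← hNl m, Finset.sum_mul]
    exact Finset.sum_congr rfl fun i _ => by ring_nf
  have hee : ∀ i, ∑ m, C ((N * M) m i) * e m = e i := by
    intro i
    simp only [he, Finset.mul_sum]
    rw [Finset.sum_comm]
    refine Finset.sum_congr rfl fun m _ => ?_
    conv_rhs => rw [← hidem, Matrix.mul_apply, map_sum, Finset.sum_mul]
    exact Finset.sum_congr rfl fun j _ => by rw [map_mul]; ring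
  -- The operator `k + Q` on the right of `sum_mul_antisymm`, with `Q` the map `c ↦ e`, is inverted:
  -- since `Q` is idempotent, its inverse is `k⁻¹ (1 - (k + 1)⁻¹ Q)`. This is where `k ≥ 1` is
  -- needed.
  set c' : ι → MvPolynomial σ F := fun i => C ((k : F)⁻¹) * (c i - C (((k : F) + 1)⁻¹) * e i)
    with hc'
  have hehom : ∀ i, (e i).IsHomogeneous k := fun i =>
    IsHomogeneous.sum _ _ _ fun m _ => (hc m).C_mul _
  have hc'hom : ∀ i, (c' i).IsHomogeneous k := fun i =>
    ((hc i).sub ((hehom i).C_mul _)).C_mul _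
  have hc'syz : ∑ i, l i * c' i = 0 := by
    have : ∀ i, l i * c' i = C ((k : F)⁻¹) * (l i * c i) -
        C ((k : F)⁻¹) * C (((k : F) + 1)⁻¹) * (l i * e i) := by
      intro i; simp only [hc']; ring
    simp only [this, Finset.sum_sub_distrib, ← Finset.mul_sum, hsyz, hesyz]
    simp
  refine ⟨fun i m => linDer M m (c' i) - linDer M i (c' m), fun i j =>
    (linDer_isHomogeneous _ _ (hc'hom i)).sub (linDer_isHomogeneous _ _ (hc'hom j)),
    fun i j => by ring, fun i => ?_⟩
  rw [sum_mul_antisymm hl hMN hc'hom hc'syz]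
  have h2 : ∑ m, C ((N * M) m i) * c' m = C ((k : F)⁻¹) * (e i - C (((k : F) + 1)⁻¹) * e i) := by
    have : ∀ m, C ((N * M) m i) * c' m = C ((k : F)⁻¹) * (C ((N * M) m i) * c m) -
        C ((k : F)⁻¹) * C (((k : F) + 1)⁻¹) * (C ((N * M) m i) * e m) := by
      intro m; simp only [hc']; ring
    simp only [this, Finset.sum_sub_distrib, ← Finset.mul_sum, hee]
    simp only [he]
    ring
  rw [h2, nsmul_eq_mul]
  have hkC : (C ((k : F)⁻¹) : MvPolynomial σ F) * (k : MvPolynomial σ F) = 1 := by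
    rw [← map_natCast C, ← map_mul, inv_mul_cancel₀ hk0, map_one]
  have hkC1 : (C (((k : F) + 1)⁻¹) : MvPolynomial σ F) * ((k : MvPolynomial σ F) + 1) = 1 := by
    rw [← map_natCast C, ← map_one C, ← map_add, ← map_mul, inv_mul_cancel₀ hk1]
  simp only [hc']
  linear_combination -c i * hkC + C (k : F)⁻¹ * e i * hkC1

end Koszul

end RationalDBA
end

/-! ### Bigraded forms and the gluing condition -/

noncomputable section

namespace RationalDBA

open MvPolynomial

section Bihomogeneous

variable {g : ℕ} {F : Type*} [Field F]

theorem weight_bideg (d : Coord g →₀ ℕ) : Finsupp.weight (bideg g) d =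
    (∑ a, d (Sum.inl a), ∑ j, d (Sum.inr j)) := by
  rw [Finsupp.weight_apply, Finsupp.sum_fintype _ _ (by simp), Fintype.sum_sum_type]
  ext <;> simp [bideg, Prod.fst_sum, Prod.snd_sum]

theorem isHomogeneous_aeval_of_bideg {τ : Type*} {x : Coord g → MvPolynomial τ F}
    (hl : ∀ a, (x (Sum.inl a)).IsHomogeneous 0) (hr : ∀ j, (x (Sum.inr j)).IsHomogeneous 1)
    {p : MvPolynomial (Coord g) F} {k l : ℕ} (hp : IsWeightedHomogeneous (bideg g) p (k, l)) :
    (aeval x p).IsHomogeneous l := by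
  rw [aeval_def, eval₂_eq]
  refine IsHomogeneous.sum _ _ _ fun d hd => IsHomogeneous.C_mul ?_ _
  have hw := hp (mem_support_iff.mp hd)
  rw [weight_bideg, Prod.mk.injEq] at hw
  rw [Finset.prod_subset (Finset.subset_univ d.support) (fun i _ hi => by
    rw [Finsupp.notMem_support_iff.mp hi, pow_zero]), Fintype.prod_sum_type, ← hw.2,
    ← zero_add (∑ j, _)]
  refine IsHomogeneous.mul ?_ (IsHomogeneous.prod _ _ _ fun j _ => by simpa using (hr j).pow _)
  rw [← Finset.sum_const_zero (s := (Finset.univ : Finset (Fin 2)))]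
  exact IsHomogeneous.prod _ _ _ fun j _ => by simpa using (hl j).pow _

theorem rename_inr_bideg {p : MvPolynomial (Fin g) F} {k : ℕ} (hp : p.IsHomogeneous k) :
    IsWeightedHomogeneous (bideg g) (rename (Sum.inr : Fin g → Coord g) p) (0, k) := by
  rw [rename_eq_aeval, aeval_def, eval₂_eq]
  refine IsWeightedHomogeneous.sum _ _ _ fun d hd => ?_
  have hw := hp (mem_support_iff.mp hd)
  rw [← zero_add ((0, k) : ℕ × ℕ)]
  refine (isWeightedHomogeneous_C _ _).mul ?_
  have : ((0, k) : ℕ × ℕ) = ∑ i ∈ d.support, d i • bideg g (Sum.inr i) := by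
    rw [← hw]
    ext <;> simp [bideg, Prod.fst_sum, Prod.snd_sum, Finsupp.weight_apply, Finsupp.sum]
  rw [this]
  exact IsWeightedHomogeneous.prod _ _ _ fun i _ => (isWeightedHomogeneous_X _ _ _).pow _

theorem exists_eq_single_add_single_add {d : Coord g →₀ ℕ} {k : ℕ}
    (hd : Finsupp.weight (bideg g) d = (k + 1, k + 1)) :
    ∃ a j d', d = Finsupp.single (Sum.inl a) 1 + Finsupp.single (Sum.inr j) 1 + d' ∧
      Finsupp.weight (bideg g) d' = (k, k) := by
  have hd' := hd
  rw [weight_bideg, Prod.mk.injEq] at hd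
  obtain ⟨a, -, ha⟩ := Finset.exists_ne_zero_of_sum_ne_zero
    (by rw [hd.1]; omega : ∑ a, d (Sum.inl a) ≠ 0)
  obtain ⟨j, -, hj⟩ := Finset.exists_ne_zero_of_sum_ne_zero
    (by rw [hd.2]; omega : ∑ j, d (Sum.inr j) ≠ 0)
  have hle : Finsupp.single (Sum.inl a) 1 + Finsupp.single (Sum.inr j) 1 ≤ d := by
    intro i
    rcases i with i | i
    · by_cases hi : i = a
      · subst hi; simp; omega
      · simp [Ne.symm hi]
    · by_cases hi : i = j
      · subst hi; simp; omega
      · simp [Ne.symm hi]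
  obtain ⟨d', rfl⟩ := exists_add_of_le hle
  refine ⟨a, j, d', rfl, ?_⟩
  rw [map_add, map_add, Finsupp.weight_single, Finsupp.weight_single] at hd'
  refine add_left_cancel (hd'.trans (b := _) ?_)
  ext <;> simp [bideg, add_comm]

/-- If a family of forms of bidegree `(1, 1)` generates all forms of bidegree `(2, 2)` over those of
bidegree `(1, 1)`, then it generates all forms of bidegree `(k + 1, k + 1)` over those of bidegree
`(k, k)`, for every `k ≥ 1`. -/
theorem exists_sum_mul_of_two {ι : Type*} [Fintype ι] {fs : ι → MvPolynomial (Coord g) F}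
    (h2 : ∀ d : Coord g →₀ ℕ, Finsupp.weight (bideg g) d = (2, 2) →
      ∃ G : ι → MvPolynomial (Coord g) F,
        (∀ i, IsWeightedHomogeneous (bideg g) (G i) (1, 1)) ∧ monomial d 1 = ∑ i, fs i * G i)
    {k : ℕ} (hk : 1 ≤ k) {H : MvPolynomial (Coord g) F}
    (hH : IsWeightedHomogeneous (bideg g) H (k + 1, k + 1)) :
    ∃ G : ι → MvPolynomial (Coord g) F,
      (∀ i, IsWeightedHomogeneous (bideg g) (G i) (k, k)) ∧ H = ∑ i, fs i * G i := by
  have hmon : ∀ k, 1 ≤ k → ∀ d : Coord g →₀ ℕ,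
      Finsupp.weight (bideg g) d = (k + 1, k + 1) →
      ∃ G : ι → MvPolynomial (Coord g) F,
        (∀ i, IsWeightedHomogeneous (bideg g) (G i) (k, k)) ∧ monomial d 1 = ∑ i, fs i * G i := by
    intro k hk
    induction k, hk using Nat.le_induction with
    | base => exact h2
    | succ k hk ih =>
      intro d hd
      obtain ⟨a, j, d', rfl, hw'⟩ := exists_eq_single_add_single_add hd
      obtain ⟨G, hG, hd⟩ := ih d' hw'
      refine ⟨fun i => X (Sum.inl a) * X (Sum.inr j) * G i, fun i => ?_, ?_⟩
      · have := ((isWeightedHomogeneous_X F (bideg g) (Sum.inl a)).mul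
          (isWeightedHomogeneous_X F (bideg g) (Sum.inr j))).mul (hG i)
        convert this using 1
        simp [bideg, add_comm]
      · rw [← mul_one (1 : F), ← monomial_mul, hd, ← mul_one (1 : F), ← monomial_mul,
          Finset.mul_sum]
        exact Finset.sum_congr rfl fun i _ => by simp only [X]; ring
  have hch : ∀ d : Coord g →₀ ℕ, ∃ G : ι → MvPolynomial (Coord g) F,
        (∀ i, IsWeightedHomogeneous (bideg g) (G i) (k, k)) ∧
          (d ∈ H.support → monomial d 1 = ∑ i, fs i * G i) := by
    intro d
    by_cases hd : d ∈ H.support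
    · obtain ⟨G, hG, h⟩ := hmon k hk d (hH (mem_support_iff.mp hd))
      exact ⟨G, hG, fun _ => h⟩
    · exact ⟨0, fun i => isWeightedHomogeneous_zero _ _ _, fun h => absurd h hd⟩
  choose G hG hGd using hch
  refine ⟨fun i => ∑ d ∈ H.support, C (coeff d H) * G d i, fun i =>
    IsWeightedHomogeneous.sum _ _ _ fun d _ => ?_, ?_⟩
  · simpa using (isWeightedHomogeneous_C _ _).mul (hG d i)
  · conv_lhs => rw [H.as_sum]
    simp only [Finset.mul_sum]
    rw [Finset.sum_comm]
    refine Finset.sum_congr rfl fun d hd => ?_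
    rw [← mul_one (coeff d H), ← C_mul_monomial, hGd d hd, Finset.mul_sum]
    exact Finset.sum_congr rfl fun i _ => by rw [mul_one]; ring

end Bihomogeneous

namespace Data

variable {g : ℕ} (S : Data g) (F : Type) [Field F] [Algebra ℂ F]

theorem det_ne : S.p₁ 0 * S.p₂ 1 - S.p₁ 1 * S.p₂ 0 ≠ 0 := by
  intro h
  apply S.p_ne
  rw [Projectivization.mk_eq_mk_iff']
  by_cases h0 : S.p₂ 0 = 0
  · have h1 : S.p₂ 1 ≠ 0 := by
      intro h1; apply S.p₂_ne; ext i; fin_cases i <;> simp [h0, h1]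
    refine ⟨S.p₁ 1 / S.p₂ 1, ?_⟩
    have h2 : S.p₁ 0 = 0 := by simpa [h0, h1] using h
    ext i; fin_cases i
    · simp [h0, h2]
    · simp [h1]
  · refine ⟨S.p₁ 0 / S.p₂ 0, ?_⟩
    ext i; fin_cases i
    · simp [h0]
    · simp only [Fin.mk_one, Pi.smul_apply, smul_eq_mul]
      field_simp
      linear_combination h

/-- The linear form in `z` that is `1` at `p₁` and `0` at `p₂`. -/
def form₁ : MvPolynomial (Coord g) F :=
  C (algebraMap ℂ F (S.p₂ 1 / (S.p₁ 0 * S.p₂ 1 - S.p₁ 1 * S.p₂ 0))) * X (Sum.inl 0) -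
    C (algebraMap ℂ F (S.p₂ 0 / (S.p₁ 0 * S.p₂ 1 - S.p₁ 1 * S.p₂ 0))) * X (Sum.inl 1)

theorem rest₁_form₁ : S.rest₁ F (S.form₁ F) = 1 := by
  simp only [form₁, rest₁, map_sub, map_mul, aeval_X, algHom_C, Sum.elim_inl, algebraMap_eq]
  simp only [← map_mul, ← map_sub]
  rw [show S.p₂ 1 / (S.p₁ 0 * S.p₂ 1 - S.p₁ 1 * S.p₂ 0) * S.p₁ 0 -
    S.p₂ 0 / (S.p₁ 0 * S.p₂ 1 - S.p₁ 1 * S.p₂ 0) * S.p₁ 1 = 1 by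
      have := S.det_ne; rw [div_mul_eq_mul_div, div_mul_eq_mul_div, ← sub_div]; rw [div_eq_one_iff_eq this]; ring]
  simp

theorem rest₂_form₁ : S.rest₂ F (S.form₁ F) = 0 := by
  simp only [form₁, rest₂, map_sub, map_mul, aeval_X, algHom_C, Sum.elim_inl, algebraMap_eq]
  simp only [← map_mul, ← map_sub]
  rw [show S.p₂ 1 / (S.p₁ 0 * S.p₂ 1 - S.p₁ 1 * S.p₂ 0) * S.p₂ 0 -
    S.p₂ 0 / (S.p₁ 0 * S.p₂ 1 - S.p₁ 1 * S.p₂ 0) * S.p₂ 1 = 0 by ring]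
  simp

theorem form₁_isWeightedHomogeneous : IsWeightedHomogeneous (bideg g) (S.form₁ F) (1, 0) := by
  have h0 : ∀ (c : F) (i : Fin 2),
      IsWeightedHomogeneous (bideg g) (C c * X (Sum.inl i)) (1, 0) := by
    intro c i
    have := (isWeightedHomogeneous_C (R := F) (bideg g) c).mul
      (isWeightedHomogeneous_X F (bideg g) (Sum.inl i))
    simpa [bideg] using this
  exact (h0 _ 0).sub (h0 _ 1)

theorem rest₁_rename (w : MvPolynomial (Fin g) F) : S.rest₁ F (rename Sum.inr w) = w := by
  rw [rest₁, aeval_rename]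
  exact aeval_X_left_apply w

variable {F}

theorem rest₁_isHomogeneous {p : MvPolynomial (Coord g) F} {k l : ℕ}
    (hp : IsWeightedHomogeneous (bideg g) p (k, l)) : (S.rest₁ F p).IsHomogeneous l :=
  by
  refine isHomogeneous_aeval_of_bideg (fun a => ?_) (fun j => ?_) hp
  · exact isHomogeneous_C _ _
  · exact isHomogeneous_X _ _

theorem rest₂_isHomogeneous {p : MvPolynomial (Coord g) F} {k l : ℕ}
    (hp : IsWeightedHomogeneous (bideg g) p (k, l)) : (S.rest₂ F p).IsHomogeneous l :=
  by
  refine isHomogeneous_aeval_of_bideg (fun a => ?_) (fun j => ?_) hp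
  · exact isHomogeneous_C _ _
  · exact IsHomogeneous.sum _ _ _ fun _ _ => (isHomogeneous_X _ _).C_mul _

/-- The difference of the two sides of the gluing condition with multiplier `A^k lam`. -/
def glue (lam : F) (k : ℕ) : MvPolynomial (Coord g) F →ₗ[F] MvPolynomial (Fin g) F :=
  (S.rest₁ F).toLinearMap - (algebraMap ℂ F S.A ^ k * lam) • (S.rest₂ F).toLinearMap

theorem glue_apply (lam : F) (k : ℕ) (H : MvPolynomial (Coord g) F) :
    S.glue lam k H = S.rest₁ F H - C (algebraMap ℂ F S.A ^ k * lam) * S.rest₂ F H := by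
  rw [← smul_eq_C_mul]; rfl

/-- The forms of bidegree `(k, k)` that satisfy the gluing condition with multiplier `A^k lam`. -/
def W (lam : F) (k : ℕ) : Submodule F (MvPolynomial (Coord g) F) :=
  weightedHomogeneousSubmodule F (bideg g) (k, k) ⊓ LinearMap.ker (S.glue lam k)

theorem glue_isHomogeneous (lam : F) {k : ℕ} {H : MvPolynomial (Coord g) F}
    (hH : IsWeightedHomogeneous (bideg g) H (k, k)) : (S.glue lam k H).IsHomogeneous k := by
  rw [glue_apply]
  exact (S.rest₁_isHomogeneous hH).sub ((S.rest₂_isHomogeneous hH).C_mul _)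

/-- For `k ≥ 1`, multiply `w` by the `k`-th power of the form in `z` that is `1` at `p₁` and `0` at
`p₂`. For `k = 0` only constants are available, on which gluing is multiplication by `1 - lam`. -/
theorem exists_glue_eq {lam : F} {k : ℕ} (h : k = 0 → lam ≠ 1) {w : MvPolynomial (Fin g) F}
    (hw : w.IsHomogeneous k) :
    ∃ H, IsWeightedHomogeneous (bideg g) H (k, k) ∧ S.glue lam k H = w := by
  rcases Nat.eq_zero_or_pos k with rfl | hk
  · obtain ⟨c, rfl⟩ : ∃ c, w = C c :=
      ⟨_, (totalDegree_eq_zero_iff_eq_C.mp (Nat.le_zero.mp hw.totalDegree_le))⟩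
    refine ⟨C ((1 - lam)⁻¹ * c), isWeightedHomogeneous_C _ _, ?_⟩
    have h1 : (1 - lam) ≠ 0 := sub_ne_zero.mpr (h rfl).symm
    rw [glue_apply, algHom_C, algHom_C, algebraMap_eq, ← map_mul, ← map_sub]
    congr 1
    field_simp
  · refine ⟨S.form₁ F ^ k * rename Sum.inr w, ?_, ?_⟩
    · have := ((S.form₁_isWeightedHomogeneous F).pow k).mul (rename_inr_bideg hw)
      simpa using this
    · rw [glue_apply, map_mul (S.rest₁ F), map_mul (S.rest₂ F), map_pow (S.rest₁ F),
        map_pow (S.rest₂ F), rest₁_form₁, rest₂_form₁, zero_pow hk.ne', rest₁_rename]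
      ring

theorem glue_mul {lam μ : F} (hμ : μ ≠ 0) {k : ℕ} {f G : MvPolynomial (Coord g) F}
    (hf : S.rest₁ F f = C (algebraMap ℂ F S.A * μ) * S.rest₂ F f) :
    S.glue lam (k + 1) (f * G) = S.rest₁ F f * S.glue (lam / μ) k G := by
  rw [glue_apply, glue_apply, map_mul (S.rest₁ F), map_mul (S.rest₂ F), hf]
  have : algebraMap ℂ F S.A ^ (k + 1) * lam =
      algebraMap ℂ F S.A * μ * (algebraMap ℂ F S.A ^ k * (lam / μ)) := by
    field_simp
    ring
  rw [this, C_mul (a := algebraMap ℂ F S.A * μ)]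
  ring

/-- Write `H = ∑ fᵢ Gᵢ` without regard to gluing. By `glue_mul` the gluing defects of the `Gᵢ` form
a syzygy of the linear forms `fᵢ(p₁, ·)`, hence a Koszul one. Lifting its antisymmetric coefficients
to forms in `(z, t)` gives a correction that removes the defects and, being antisymmetric, leaves `∑
fᵢ Gᵢ` unchanged. -/
theorem exists_sum_mul_of_mem_W [CharZero F] {ι : Type*} [Fintype ι]
    {fs : ι → MvPolynomial (Coord g) F} {μ : ι → F} (hμ : ∀ i, μ i ≠ 0)
    (hfs : ∀ i, IsWeightedHomogeneous (bideg g) (fs i) (1, 1))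
    (hglue : ∀ i, S.rest₁ F (fs i) = C (algebraMap ℂ F S.A * μ i) * S.rest₂ F (fs i))
    {N : Matrix ι (Fin g) F} {M : Matrix (Fin g) ι F}
    (hl : ∀ i, S.rest₁ F (fs i) = ∑ j, C (N i j) * X j) (hMN : M * N = 1)
    (h2 : ∀ d : Coord g →₀ ℕ, Finsupp.weight (bideg g) d = (2, 2) →
      ∃ G : ι → MvPolynomial (Coord g) F,
        (∀ i, IsWeightedHomogeneous (bideg g) (G i) (1, 1)) ∧ monomial d 1 = ∑ i, fs i * G i)
    {lam : F} (hlam : ∀ i j, lam / μ i / μ j ≠ 1) {k : ℕ} (hk : 1 ≤ k)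
    {H : MvPolynomial (Coord g) F} (hH : H ∈ S.W lam (k + 1)) :
    ∃ G : ι → MvPolynomial (Coord g) F, (∀ i, G i ∈ S.W (lam / μ i) k) ∧
      H = ∑ i, fs i * G i := by
  classical
  obtain ⟨G, hG, hHG⟩ := exists_sum_mul_of_two h2 hk hH.1
  have hsyz : ∑ i, S.rest₁ F (fs i) * S.glue (lam / μ i) k (G i) = 0 := by
    have h0 : S.glue lam (k + 1) H = 0 := hH.2
    rw [hHG, map_sum] at h0
    rw [← h0]
    exact Finset.sum_congr rfl fun i _ => (S.glue_mul (hμ i) (hglue i)).symm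
  obtain ⟨w, hw, hanti, hcw⟩ := exists_koszul hl hMN hk
    (fun i => S.glue_isHomogeneous _ (hG i)) hsyz
  -- Half of `w i j` is lifted, so that the antisymmetric `Y i j - Y j i` has defect exactly `w i
  -- j`. For `k = 1` the lift has bidegree `(0, 0)`, whence the hypothesis `hlam`.
  have hex : ∀ i j, ∃ Y, IsWeightedHomogeneous (bideg g) Y (k - 1, k - 1) ∧
      S.glue (lam / μ i / μ j) (k - 1) Y = C (2⁻¹ : F) * w i j := fun i j =>
    S.exists_glue_eq (fun _ => hlam i j) ((hw i j).C_mul _)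
  choose Y hY hYw using hex
  refine ⟨fun i => G i - ∑ j, fs j * (Y i j - Y j i), fun i => ⟨?_, ?_⟩, ?_⟩
  · refine (hG i).sub (IsWeightedHomogeneous.sum _ _ _ fun j _ => ?_)
    have := (hfs j).mul ((hY i j).sub (hY j i))
    rwa [Prod.mk_add_mk, Nat.add_sub_cancel' hk] at this
  · change S.glue _ _ (_ - _) = 0
    rw [map_sub, hcw i, map_sum, ← Finset.sum_sub_distrib]
    refine Finset.sum_eq_zero fun j _ => ?_
    obtain ⟨m, rfl⟩ : ∃ m, k = m + 1 := ⟨k - 1, by omega⟩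
    rw [S.glue_mul (hμ j) (hglue j), map_sub]
    rw [Nat.add_sub_cancel] at hYw
    rw [hYw i j, div_right_comm, hYw j i, hanti j i, ← mul_sub]
    have h3 : (C (2⁻¹ : F) : MvPolynomial (Fin g) F) * 2 = 1 := by
      rw [← map_ofNat C 2, ← map_mul, inv_mul_cancel₀ two_ne_zero, map_one]
    linear_combination (- S.rest₁ F (fs j) * w i j) * h3
  · simp only [mul_sub, Finset.sum_sub_distrib, ← hHG, Finset.mul_sum]
    have : ∑ i, ∑ j, fs i * (fs j * Y j i) = ∑ i, ∑ j, fs i * (fs j * Y i j) := by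
      rw [Finset.sum_comm]
      exact Finset.sum_congr rfl fun i _ => Finset.sum_congr rfl fun j _ => by ring
    rw [this]
    ring

end Data
end RationalDBA
end

/-! ### The gluing condition linearized at `s = 0` -/

noncomputable section

namespace RationalDBA

open MvPolynomial Filter Topology

/-- Express the standard basis through `u₀`. The same combinations of `u x` converge to that basis,
and linear independence is an open condition. -/
theorem eventually_span_eq_top {X ι κ : Type*} [Finite ι] [Finite κ] {l : Filter X}
    {u : X → κ → ι → ℂ} {u₀ : κ → ι → ℂ} (hu : ∀ p, Tendsto (fun x => u x p) l (𝓝 (u₀ p)))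
    (h : Submodule.span ℂ (Set.range u₀) = ⊤) :
    ∀ᶠ x in l, Submodule.span ℂ (Set.range (u x)) = ⊤ := by
  classical
  have := Fintype.ofFinite ι
  have := Fintype.ofFinite κ
  have hc : ∀ i : ι, ∃ c : κ → ℂ, ∑ p, c p • u₀ p = Pi.basisFun ℂ ι i := fun i => by
    rw [← Submodule.mem_span_range_iff_exists_fun, h]; trivial
  choose c hc using hc
  have ht : Tendsto (fun x i => ∑ p, c i p • u x p) l (𝓝 (Pi.basisFun ℂ ι)) := by
    rw [tendsto_pi_nhds]
    intro i
    rw [← hc i]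
    exact tendsto_finsetSum _ fun p _ => (hu p).const_smul _
  filter_upwards [ht.eventually (Pi.basisFun ℂ ι).linearIndependent.eventually] with x hx
  rw [eq_top_iff, ← hx.span_eq_top_of_card_eq_finrank' (by simp), Submodule.span_le]
  rintro _ ⟨i, rfl⟩
  exact Submodule.sum_mem _ fun p _ => Submodule.smul_mem _ _ (Submodule.subset_span ⟨p, rfl⟩)

section LinearForms

variable {g : ℕ}

/-- A linear functional of `t` as a polynomial. -/
def lin : Module.Dual ℂ (Fin g → ℂ) →ₗ[ℂ] MvPolynomial (Coord g) ℂ where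
  toFun b := ∑ k, C (b (Pi.single k 1)) * X (Sum.inr k)
  map_add' b b' := by simp [add_mul, Finset.sum_add_distrib]
  map_smul' c b := by
    simp only [LinearMap.smul_apply, smul_eq_mul, map_mul, RingHom.id_apply, Finset.smul_sum,
      smul_eq_C_mul, mul_assoc]

theorem eval_lin (b : Module.Dual ℂ (Fin g → ℂ)) (z : Fin 2 → ℂ) (t : Fin g → ℂ) :
    eval (Sum.elim z t) (lin b) = b t := by
  conv_rhs => rw [pi_eq_sum_univ' t]
  simp [lin, mul_comm]

/-- The functional `t ↦ ∑ₖ (aₖ z₁ + bₖ z₂) tₖ`. -/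
def bilinAt (a b : Fin g → ℂ) (z : Fin 2 → ℂ) : Module.Dual ℂ (Fin g → ℂ) :=
  ∑ k, (a k * z 0 + b k * z 1) • LinearMap.proj k

theorem bilinAt_apply (a b : Fin g → ℂ) (z : Fin 2 → ℂ) (t : Fin g → ℂ) :
    bilinAt a b z t = ∑ k, (a k * z 0 + b k * z 1) * t k := by
  simp [bilinAt]

theorem eval_ext {p q : MvPolynomial (Coord g) ℂ}
    (h : ∀ z t, eval (Sum.elim z t) p = eval (Sum.elim z t) q) : p = q := by
  apply MvPolynomial.funext
  intro x
  have hx' : x = Sum.elim (fun a => x (Sum.inl a)) (fun a => x (Sum.inr a)) := by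
    ext a; cases a <;> rfl
  rw [hx']
  exact h _ _

end LinearForms

namespace Data

variable {g : ℕ} (S : Data g)

/-- The linear form in `z` that is `0` at `p₁` and `1` at `p₂`. -/
def form₂ : MvPolynomial (Coord g) ℂ :=
  C (S.p₁ 0 / (S.p₁ 0 * S.p₂ 1 - S.p₁ 1 * S.p₂ 0)) * X (Sum.inl 1) -
    C (S.p₁ 1 / (S.p₁ 0 * S.p₂ 1 - S.p₁ 1 * S.p₂ 0)) * X (Sum.inl 0)

/-- `∂ₛ F_i(·, 0)` -/
def dF (i : Fin g) : MvPolynomial (Coord g) ℂ :=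
  bilin (fun k => deriv (S.γ i k) 0) (fun k => deriv (S.δ i k) 0)

theorem X_inl_eq (a : Fin 2) : (X (Sum.inl a) : MvPolynomial (Coord g) ℂ) =
    S.p₁ a • S.form₁ ℂ + S.p₂ a • S.form₂ := by
  apply eval_ext
  intro z t
  have h := S.det_ne
  generalize hD : S.p₁ 0 * S.p₂ 1 - S.p₁ 1 * S.p₂ 0 = D at h
  fin_cases a <;> simp [form₁, form₂, smul_eval, hD] <;> field_simp <;> rw [← hD] <;> ring

theorem bilin_eq (a b : Fin g → ℂ) : bilin a b =
    S.form₁ ℂ * lin (bilinAt a b S.p₁) + S.form₂ * lin (bilinAt a b S.p₂) := by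
  apply eval_ext
  intro z t
  have h := S.det_ne
  rw [eval_bilin, map_add, map_mul, map_mul, eval_lin, eval_lin, bilinAt_apply, bilinAt_apply,
    Finset.mul_sum, Finset.mul_sum, ← Finset.sum_add_distrib]
  refine Finset.sum_congr rfl fun k _ => ?_
  simp only [form₁, form₂, map_sub, map_mul, eval_C, eval_X, Sum.elim_inl, Algebra.algebraMap_self,
    RingHom.id_apply]
  generalize hD : S.p₁ 0 * S.p₂ 1 - S.p₁ 1 * S.p₂ 0 = D at h
  field_simp
  rw [← hD]
  ring

/-- The functional `t ↦ f(p₂, 𝒫 t)`. -/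
def bP : Module.Dual ℂ (Fin g → ℂ) := bilinAt S.α S.β S.p₂ ∘ₗ S.P.toLinearMap

theorem bilinAt_f : bilinAt S.α S.β S.p₁ = S.A • S.bP := by
  refine LinearMap.ext fun t => ?_
  have := S.f_glue t
  rwa [f, eval_bilin, eval_bilin, ← bilinAt_apply, ← bilinAt_apply] at this

theorem hasDerivAt_γ (i k : Fin g) : HasDerivAt (S.γ i k) (deriv (S.γ i k) 0) 0 :=
  (S.γ_diff i k).hasDerivAt

theorem hasDerivAt_δ (i k : Fin g) : HasDerivAt (S.δ i k) (deriv (S.δ i k) 0) 0 :=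
  (S.δ_diff i k).hasDerivAt

/-- The derivative of `F_i(p₁, t, s) = A e^s F_i(p₂, 𝒫 t, s)` at `s = 0`; the summand `bP` comes
from the factor `e^s`. -/
theorem bilinAt_dF (i : Fin g) :
    bilinAt (fun k => deriv (S.γ i k) 0) (fun k => deriv (S.δ i k) 0) S.p₁ =
      S.A • (bilinAt (fun k => deriv (S.γ i k) 0) (fun k => deriv (S.δ i k) 0) S.p₂ ∘ₗ
        S.P.toLinearMap + S.bP) := by
  have hd : ∀ (z : Fin 2 → ℂ) (t : Fin g → ℂ), HasDerivAt
      (fun s => bilinAt (fun k => S.γ i k s) (fun k => S.δ i k s) z t)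
      (bilinAt (fun k => deriv (S.γ i k) 0) (fun k => deriv (S.δ i k) 0) z t) 0 := by
    intro z t
    simp only [bilinAt_apply]
    exact HasDerivAt.fun_sum fun k _ =>
      (((S.hasDerivAt_γ i k).mul_const _).add ((S.hasDerivAt_δ i k).mul_const _)).mul_const _
  refine LinearMap.ext fun t => ?_
  have h1 := hd S.p₁ t
  have h2 := ((((Complex.hasDerivAt_exp 0)).const_mul S.A).mul (hd S.p₂ (S.P t)))
  have he : (fun s => bilinAt (fun k => S.γ i k s) (fun k => S.δ i k s) S.p₁ t) =
      (fun s => S.A * Complex.exp s) *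
        (fun s => bilinAt (fun k => S.γ i k s) (fun k => S.δ i k s) S.p₂ (S.P t)) := by
    ext s
    have := S.F_glue i s t
    rw [eval_bilin, eval_bilin, ← bilinAt_apply, ← bilinAt_apply] at this
    exact this
  rw [he] at h1
  rw [h1.unique h2]
  simp only [Complex.exp_zero, mul_one, S.γ_zero, S.δ_zero, bP, LinearMap.smul_apply,
    LinearMap.add_apply, LinearMap.comp_apply, smul_eq_mul, LinearEquiv.coe_coe]
  ring

/-- The forms that satisfy the linearized gluing condition. -/
def linGlue : Module.Dual ℂ (Fin g → ℂ) × ℂ →ₗ[ℂ] MvPolynomial (Coord g) ℂ :=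
  LinearMap.mulLeft ℂ (S.form₁ ℂ) ∘ₗ lin ∘ₗ (S.A •
    LinearMap.coprod (LinearMap.lcomp ℂ ℂ S.P.toLinearMap) (LinearMap.toSpanSingleton ℂ _ S.bP)) +
  LinearMap.mulLeft ℂ S.form₂ ∘ₗ lin ∘ₗ LinearMap.fst ℂ _ _

theorem linGlue_apply (b : Module.Dual ℂ (Fin g → ℂ)) (c : ℂ) : S.linGlue (b, c) =
    S.form₁ ℂ * lin (S.A • (b ∘ₗ S.P.toLinearMap + c • S.bP)) + S.form₂ * lin b := rfl

/-- The `g + 1` limit forms are independent and satisfy the linearized condition, whose solutions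
depend on `g + 1` parameters: the value at `p₂` and one scalar. -/
theorem span_limit : Submodule.span ℂ (Set.range (Fin.cons S.f S.dF :
      Fin (g + 1) → MvPolynomial (Coord g) ℂ)) = LinearMap.range S.linGlue := by
  apply Submodule.eq_of_le_of_finrank_le
  · rw [Submodule.span_le]
    rintro _ ⟨i, rfl⟩
    refine Fin.cases ?_ (fun i => ?_) i
    · exact ⟨(bilinAt S.α S.β S.p₂, 0), by
        rw [linGlue_apply, Fin.cons_zero, f, S.bilin_eq, bilinAt_f, zero_smul, add_zero]
        rfl⟩
    · exact ⟨(bilinAt (fun k => deriv (S.γ i k) 0) (fun k => deriv (S.δ i k) 0) S.p₂, 1), by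
        rw [linGlue_apply, Fin.cons_succ, dF, S.bilin_eq, bilinAt_dF, one_smul]⟩
  · refine (LinearMap.finrank_range_le _).trans ?_
    have h := finrank_span_eq_card S.linInd
    rw [Fintype.card_fin] at h
    refine le_trans (le_of_eq ?_) h.ge
    rw [Module.finrank_prod, Subspace.dual_finrank_eq]
    simp

/-- The basis of eigenvectors of `𝒫`. -/
def eigBasis : Module.Basis (Fin g) ℂ (Fin g → ℂ) :=
  basisOfLinearIndependentOfCardEqFinrank' S.v
    (Module.End.eigenvectors_linearIndependent' S.P.toLinearMap S.eig S.eig_injective S.v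
      fun j => Module.End.hasEigenvector_iff.mpr
        ⟨Module.End.mem_eigenspace_iff.mpr (S.P_v j), S.v_ne j⟩) (by simp)

theorem eigBasis_apply (j : Fin g) : S.eigBasis j = S.v j := by simp [eigBasis]

theorem coord_comp_P (j : Fin g) :
    S.eigBasis.coord j ∘ₗ S.P.toLinearMap = S.eig j • S.eigBasis.coord j := by
  refine S.eigBasis.ext fun i => ?_
  rw [LinearMap.comp_apply, LinearEquiv.coe_coe, eigBasis_apply, P_v, ← eigBasis_apply]
  simp only [map_smul, Module.Basis.coord_apply, Module.Basis.repr_self, LinearMap.smul_apply,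
    smul_eq_mul, Finsupp.single_apply]
  split_ifs with h
  · rw [h]
  · simp

theorem bP_v_ne (j : Fin g) : S.bP (S.v j) ≠ 0 := by
  intro h
  apply S.f_v_ne j
  change eval _ S.f = 0
  rw [f_glue, f, eval_bilin, ← bilinAt_apply]
  change S.A * S.bP (S.v j) = 0
  rw [h, mul_zero]

theorem bP_eq : S.bP = ∑ j, S.bP (S.v j) • S.eigBasis.coord j := by
  refine S.eigBasis.ext fun i => ?_
  rw [eigBasis_apply, LinearMap.sum_apply, Finset.sum_eq_single i]
  · simp [← eigBasis_apply]
  · intro j _ hj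
    simp [← eigBasis_apply, hj.symm]
  · simp

/-- The dual basis of the eigenbasis, as polynomials. -/
def eigForm (j : Fin g) : MvPolynomial (Coord g) ℂ := lin (S.eigBasis.coord j)

theorem X_inr_eq (k : Fin g) : (X (Sum.inr k) : MvPolynomial (Coord g) ℂ) =
    ∑ j, S.v j k • S.eigForm j := by
  apply eval_ext
  intro z t
  rw [eval_X, Sum.elim_inr, map_sum]
  simp only [smul_eval, eigForm, eval_lin, Module.Basis.coord_apply]
  have := congrFun (S.eigBasis.sum_repr t) k
  rw [← this, Finset.sum_apply]
  simp [eigBasis_apply, mul_comm]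

end Data
end RationalDBA
end

/-! ### Generation of the forms of bidegree `(2, 2)` -/

noncomputable section

namespace RationalDBA

open MvPolynomial Filter Topology

theorem monomial_eq_X_mul {g : ℕ} {F : Type*} [Field F] (a : Fin 2) (j : Fin g)
    (d : Coord g →₀ ℕ) :
    monomial (Finsupp.single (Sum.inl a) 1 + Finsupp.single (Sum.inr j) 1 + d) (1 : F) =
      X (Sum.inl a) * X (Sum.inr j) * monomial d 1 := by
  simp only [X, monomial_mul, mul_one]

theorem exists_eq_of_weight_one {g : ℕ} {d : Coord g →₀ ℕ}
    (hd : Finsupp.weight (bideg g) d = (1, 1)) :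
    ∃ a j, d = Finsupp.single (Sum.inl a) 1 + Finsupp.single (Sum.inr j) 1 := by
  obtain ⟨a, j, d', rfl, hd'⟩ := exists_eq_single_add_single_add (k := 0) hd
  refine ⟨a, j, ?_⟩
  rw [weight_bideg, Prod.mk.injEq, Finset.sum_eq_zero_iff, Finset.sum_eq_zero_iff] at hd'
  have : d' = 0 := by
    ext i
    rcases i with i | i
    · exact hd'.1 i (Finset.mem_univ _)
    · exact hd'.2 i (Finset.mem_univ _)
  rw [this, add_zero]

namespace Data

variable {g : ℕ} (S : Data g)

/-- The span of the products of the limit forms with forms of bidegree `(1, 1)`. -/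
def limitSpan : Submodule ℂ (MvPolynomial (Coord g) ℂ) :=
  Submodule.span ℂ (Set.range fun x : Fin (g + 1) × Fin 2 × Fin g =>
    (Fin.cons S.f S.dF : Fin (g + 1) → MvPolynomial (Coord g) ℂ) x.1 *
      (X (Sum.inl x.2.1) * X (Sum.inr x.2.2)))

theorem range_mul_mem_limitSpan {p z b : MvPolynomial (Coord g) ℂ}
    (hp : p ∈ LinearMap.range S.linGlue)
    (hz : z ∈ Submodule.span ℂ (Set.range fun a : Fin 2 =>
      (X (Sum.inl a) : MvPolynomial (Coord g) ℂ)))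
    (hb : b ∈ Submodule.span ℂ (Set.range fun j : Fin g =>
      (X (Sum.inr j) : MvPolynomial (Coord g) ℂ))) :
    p * (z * b) ∈ S.limitSpan := by
  rw [← span_limit] at hp
  have h := Submodule.mul_mem_mul hp (Submodule.mul_mem_mul hz hb)
  rw [Submodule.span_mul_span, Submodule.span_mul_span] at h
  refine Submodule.span_mono ?_ h
  rintro _ ⟨_, ⟨i, rfl⟩, _, ⟨_, ⟨a, rfl⟩, _, ⟨j, rfl⟩, rfl⟩, rfl⟩
  exact ⟨(i, a, j), rfl⟩

theorem form₁_mem : S.form₁ ℂ ∈ Submodule.span ℂ (Set.range fun a : Fin 2 =>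
    (X (Sum.inl a) : MvPolynomial (Coord g) ℂ)) := by
  simp only [form₁, ← smul_eq_C_mul]
  exact sub_mem (Submodule.smul_mem _ _ (Submodule.subset_span ⟨0, rfl⟩))
    (Submodule.smul_mem _ _ (Submodule.subset_span ⟨1, rfl⟩))

theorem form₂_mem : S.form₂ ∈ Submodule.span ℂ (Set.range fun a : Fin 2 =>
    (X (Sum.inl a) : MvPolynomial (Coord g) ℂ)) := by
  simp only [form₂, ← smul_eq_C_mul]
  exact sub_mem (Submodule.smul_mem _ _ (Submodule.subset_span ⟨1, rfl⟩))
    (Submodule.smul_mem _ _ (Submodule.subset_span ⟨0, rfl⟩))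

theorem eigForm_mem (j : Fin g) : S.eigForm j ∈ Submodule.span ℂ (Set.range fun j : Fin g =>
    (X (Sum.inr j) : MvPolynomial (Coord g) ℂ)) := by
  change ∑ k, C _ * X (Sum.inr k) ∈ _
  simp only [← smul_eq_C_mul]
  exact Submodule.sum_mem _ fun k _ => Submodule.smul_mem _ _ (Submodule.subset_span ⟨k, rfl⟩)

theorem eig_mem_range (j : Fin g) :
    ((S.A * S.eig j) • S.form₁ ℂ + S.form₂) * S.eigForm j ∈ LinearMap.range S.linGlue := by
  refine ⟨(S.eigBasis.coord j, 0), ?_⟩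
  rw [linGlue_apply, coord_comp_P, zero_smul, add_zero, map_smul, map_smul, smul_smul, add_mul,
    smul_mul_assoc, mul_smul_comm]
  rfl

theorem sum_mem_range :
    ∑ j, S.bP (S.v j) • (S.form₁ ℂ * S.eigForm j) ∈ LinearMap.range S.linGlue := by
  refine ⟨(0, S.A⁻¹), ?_⟩
  rw [linGlue_apply, LinearMap.zero_comp, zero_add, smul_smul, mul_inv_cancel₀ S.A_ne, one_smul,
    map_zero, mul_zero, add_zero, bP_eq, map_sum, Finset.mul_sum]
  refine Finset.sum_congr rfl fun j _ => ?_
  rw [map_smul, mul_smul_comm, ← bP_eq]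
  rfl

/-- Let `ζ₁, ζ₂` be the two forms in `z` and `ξ_j` the dual eigenbasis. The limit forms span `(A λ_j
ζ₁ + ζ₂) ξ_j` and `ζ₁ ∑ bP(v_j) ξ_j`. Distinct eigenvalues give `ζ₁² ξ_i ξ_j` for `i ≠ j`, the
condition `bP(v_i) ≠ 0` then gives `ζ₁² ξ_i²`, and the relations of the first kind convert `ζ₁` into
`ζ₂`. -/
theorem form_mul_eigForm_mem (i j : Fin g) :
    S.form₁ ℂ * S.form₁ ℂ * (S.eigForm i * S.eigForm j) ∈ S.limitSpan ∧
    S.form₁ ℂ * S.form₂ * (S.eigForm i * S.eigForm j) ∈ S.limitSpan ∧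
    S.form₂ * S.form₂ * (S.eigForm i * S.eigForm j) ∈ S.limitSpan := by
  set I := S.limitSpan
  have step : ∀ i j, S.form₁ ℂ * S.form₁ ℂ * (S.eigForm i * S.eigForm j) ∈ I →
      S.form₁ ℂ * S.form₁ ℂ * (S.eigForm i * S.eigForm j) ∈ I ∧
      S.form₁ ℂ * S.form₂ * (S.eigForm i * S.eigForm j) ∈ I ∧
      S.form₂ * S.form₂ * (S.eigForm i * S.eigForm j) ∈ I := by
    intro i j h11
    have h1 := S.range_mul_mem_limitSpan (S.eig_mem_range i) S.form₁_mem (S.eigForm_mem j)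
    have h2 := S.range_mul_mem_limitSpan (S.eig_mem_range i) S.form₂_mem (S.eigForm_mem j)
    have h12 : S.form₁ ℂ * S.form₂ * (S.eigForm i * S.eigForm j) ∈ I := by
      convert I.sub_mem h1 (I.smul_mem (S.A * S.eig i) h11) using 1
      simp only [smul_eq_C_mul]
      ring
    refine ⟨h11, h12, ?_⟩
    convert I.sub_mem h2 (I.smul_mem (S.A * S.eig i) h12) using 1
    simp only [smul_eq_C_mul]
    ring
  have hne : ∀ i j, i ≠ j → S.form₁ ℂ * S.form₁ ℂ * (S.eigForm i * S.eigForm j) ∈ I := by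
    intro i j hij
    -- In the difference of these two products the `ζ₁ ζ₂` terms cancel, leaving `A (λ_i - λ_j) ζ₁²
    -- ξ_i ξ_j`.
    have h1 := S.range_mul_mem_limitSpan (S.eig_mem_range i) S.form₁_mem (S.eigForm_mem j)
    have h2 := S.range_mul_mem_limitSpan (S.eig_mem_range j) S.form₁_mem (S.eigForm_mem i)
    have hc : S.A * (S.eig i - S.eig j) ≠ 0 :=
      mul_ne_zero S.A_ne (sub_ne_zero.mpr (S.eig_injective.ne hij))
    rw [← I.smul_mem_iff hc]
    convert I.sub_mem h1 h2 using 1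
    simp only [smul_eq_C_mul, map_mul, map_sub]
    ring
  refine step i j ?_
  by_cases hij : i = j
  · subst hij
    rw [← I.smul_mem_iff (S.bP_v_ne i)]
    have h := S.range_mul_mem_limitSpan S.sum_mem_range S.form₁_mem (S.eigForm_mem i)
    rw [Finset.sum_mul, ← Finset.add_sum_erase _ _ (Finset.mem_univ i)] at h
    have h2 : ∑ x ∈ Finset.univ.erase i,
        S.bP (S.v x) • (S.form₁ ℂ * S.eigForm x) * (S.form₁ ℂ * S.eigForm i) ∈ I := by
      refine I.sum_mem fun x hx => ?_
      convert I.smul_mem (S.bP (S.v x)) (hne x i (Finset.ne_of_mem_erase hx)) using 1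
      simp only [smul_eq_C_mul]
      ring
    convert I.sub_mem h h2 using 1
    simp only [smul_eq_C_mul]
    ring
  · exact hne i j hij

theorem monomial_mem_limitSpan {d : Coord g →₀ ℕ} (hd : Finsupp.weight (bideg g) d = (2, 2)) :
    monomial d 1 ∈ S.limitSpan := by
  obtain ⟨a, j, d, rfl, hd₁⟩ := exists_eq_single_add_single_add (k := 1) hd
  obtain ⟨a', j', rfl⟩ := exists_eq_of_weight_one hd₁
  rw [monomial_eq_X_mul, ← add_zero (_ + _), monomial_eq_X_mul]
  have hz : ∀ a, (X (Sum.inl a) : MvPolynomial (Coord g) ℂ) ∈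
      Submodule.span ℂ {S.form₁ ℂ, S.form₂} := by
    intro a
    rw [S.X_inl_eq, Submodule.mem_span_pair]
    exact ⟨_, _, rfl⟩
  have ht : ∀ j, (X (Sum.inr j) : MvPolynomial (Coord g) ℂ) ∈
      Submodule.span ℂ (Set.range S.eigForm) := by
    intro j
    rw [S.X_inr_eq]
    exact Submodule.sum_mem _ fun i _ => Submodule.smul_mem _ _ (Submodule.subset_span ⟨i, rfl⟩)
  have h := Submodule.mul_mem_mul (Submodule.mul_mem_mul (hz a) (hz a'))
    (Submodule.mul_mem_mul (ht j) (ht j'))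
  rw [Submodule.span_mul_span, Submodule.span_mul_span, Submodule.span_mul_span] at h
  have hle := (Submodule.span_le (p := S.limitSpan)).mpr (by
    rintro _ ⟨_, ⟨_, rfl | rfl, _, rfl | rfl, rfl⟩, _, ⟨_, ⟨i, rfl⟩, _, ⟨j, rfl⟩, rfl⟩, rfl⟩
    · exact (S.form_mul_eigForm_mem i j).1
    · exact (S.form_mul_eigForm_mem i j).2.1
    · have := (S.form_mul_eigForm_mem i j).2.1
      rwa [mul_comm (S.form₁ ℂ)] at this
    · exact (S.form_mul_eigForm_mem i j).2.2) h
  convert hle using 1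
  rw [show (monomial (0 : Coord g →₀ ℕ) (1 : ℂ)) = 1 from rfl]
  ring

/-- The form `f` together with the `F_i(·, x)`. -/
def forms (x : ℂ) : Fin (g + 1) → MvPolynomial (Coord g) ℂ := Fin.cons S.f fun i => S.F i x

theorem finite_weight (g : ℕ) (n : ℕ × ℕ) : Finite {d : Coord g →₀ ℕ //
    Finsupp.weight (bideg g) d = n} := by
  have : Finite {d : Coord g →₀ ℕ // Finsupp.weight (fun _ => 1) d = n.1 + n.2} :=
    (Finsupp.finite_of_nat_weight_eq (fun _ : Coord g => 1) (by simp) _).to_subtype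
  have h : ∀ d : Coord g →₀ ℕ, Finsupp.weight (bideg g) d = n →
      Finsupp.weight (fun _ => 1) d = n.1 + n.2 := by
    rintro d rfl
    rw [weight_bideg, Finsupp.weight_apply, Finsupp.sum_fintype _ _ (by simp),
      Fintype.sum_sum_type]
    simp
  exact Finite.of_injective _ (Subtype.map_injective (f := fun d => d) h Function.injective_id)

theorem coeff_bilin_mul (a b : Fin g → ℂ) (q : MvPolynomial (Coord g) ℂ) (d : Coord g →₀ ℕ) :
    coeff d (bilin a b * q) = ∑ k, (a k * coeff d (X (Sum.inl 0) * X (Sum.inr k) * q) +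
      b k * coeff d (X (Sum.inl 1) * X (Sum.inr k) * q)) := by
  rw [bilin, Finset.sum_mul, coeff_sum]
  refine Finset.sum_congr rfl fun k _ => ?_
  rw [← coeff_C_mul, ← coeff_C_mul, ← coeff_add]
  congr 1
  ring

theorem bilin_slope (i : Fin g) (x : ℂ) :
    bilin (fun k => slope (S.γ i k) 0 x) (fun k => slope (S.δ i k) 0 x) =
      C x⁻¹ * (S.F i x - S.f) := by
  apply eval_ext
  intro z t
  rw [map_mul, map_sub, F, f, eval_bilin, eval_bilin, eval_bilin, eval_C, ← Finset.sum_sub_distrib,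
    Finset.mul_sum]
  refine Finset.sum_congr rfl fun k _ => ?_
  simp only [slope_def_field, sub_zero, S.γ_zero, S.δ_zero, div_eq_mul_inv]
  ring

/-- At `x = 0` the forms `F_i(·, x)` all collapse to `f`. The quotients `(F_i(·, x) - f) / x` tend
to `∂ₛF_i` instead, and for `x ≠ 0` they have the same span together with `f`; spanning a
finite-dimensional space persists near the limit. -/
theorem eventually_generate : ∀ᶠ x in 𝓝[≠] (0 : ℂ), ∀ d : Coord g →₀ ℕ,
    Finsupp.weight (bideg g) d = (2, 2) → ∃ G : Fin (g + 1) → MvPolynomial (Coord g) ℂ,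
      (∀ i, IsWeightedHomogeneous (bideg g) (G i) (1, 1)) ∧
        monomial d 1 = ∑ i, S.forms x i * G i := by
  classical
  let ι := {d : Coord g →₀ ℕ // Finsupp.weight (bideg g) d = (2, 2)}
  have : Finite ι := finite_weight g (2, 2)
  let φ : ℂ → Fin (g + 1) → MvPolynomial (Coord g) ℂ := fun x =>
    Fin.cons S.f fun i => C x⁻¹ * (S.F i x - S.f)
  let φ₀ : Fin (g + 1) → MvPolynomial (Coord g) ℂ := Fin.cons S.f S.dF
  let co : MvPolynomial (Coord g) ℂ →ₗ[ℂ] (ι → ℂ) :=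
    LinearMap.pi fun d => lcoeff ℂ d.1
  have hco : ∀ p d, co p d = coeff d.1 p := fun p d => rfl
  let u : ℂ → Fin (g + 1) × Fin 2 × Fin g → ι → ℂ := fun x p =>
    co (φ x p.1 * (X (Sum.inl p.2.1) * X (Sum.inr p.2.2)))
  let u₀ : Fin (g + 1) × Fin 2 × Fin g → ι → ℂ := fun p =>
    co (φ₀ p.1 * (X (Sum.inl p.2.1) * X (Sum.inr p.2.2)))
  have hspan : Submodule.span ℂ (Set.range u₀) = ⊤ := by
    have h : Submodule.span ℂ (Set.range u₀) = S.limitSpan.map co := by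
      rw [limitSpan, Submodule.map_span, ← Set.range_comp]
      rfl
    have := Fintype.ofFinite ι
    rw [h, eq_top_iff, ← (Pi.basisFun ℂ ι).span_eq, Submodule.span_le]
    rintro _ ⟨d, rfl⟩
    refine ⟨monomial d.1 1, S.monomial_mem_limitSpan d.2, ?_⟩
    ext d'
    rw [hco, coeff_monomial, Pi.basisFun_apply, Pi.single_apply]
    exact if_congr (Subtype.ext_iff.symm.trans eq_comm) rfl rfl
  have hlim : ∀ p, Tendsto (fun x => u x p) (𝓝[≠] 0) (𝓝 (u₀ p)) := by
    rintro ⟨i, a, j⟩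
    rw [tendsto_pi_nhds]
    intro d
    refine Fin.cases ?_ (fun i => ?_) i
    · exact tendsto_const_nhds
    · simp only [u, u₀, φ, φ₀, hco, Fin.cons_succ, ← bilin_slope, dF, coeff_bilin_mul]
      refine tendsto_finsetSum _ fun k _ => Tendsto.add ?_ ?_
      · exact (hasDerivAt_iff_tendsto_slope.mp (S.hasDerivAt_γ i k)).mul_const _
      · exact (hasDerivAt_iff_tendsto_slope.mp (S.hasDerivAt_δ i k)).mul_const _
  filter_upwards [eventually_span_eq_top hlim hspan] with x hx d hd
  have hmem : co (monomial d 1) ∈ Submodule.span ℂ (Set.range (u x)) := by rw [hx]; trivial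
  obtain ⟨c, hc⟩ := (Submodule.mem_span_range_iff_exists_fun ℂ).mp hmem
  let B : Fin (g + 1) → MvPolynomial (Coord g) ℂ := fun i =>
    ∑ a, ∑ j, C (c (i, a, j)) * (X (Sum.inl a) * X (Sum.inr j))
  have hB : ∀ i, IsWeightedHomogeneous (bideg g) (B i) (1, 1) := fun i =>
    IsWeightedHomogeneous.sum _ _ _ fun a _ => IsWeightedHomogeneous.sum _ _ _ fun j _ => by
      simpa [bideg] using (isWeightedHomogeneous_C (bideg g) (c (i, a, j))).mul
        ((isWeightedHomogeneous_X ℂ (bideg g) (Sum.inl a)).mul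
          (isWeightedHomogeneous_X ℂ (bideg g) (Sum.inr j)))
  have hF : ∀ i, IsWeightedHomogeneous (bideg g) (S.F i x) (1, 1) := fun i =>
    bilin_isWeightedHomogeneous _ _
  have hφ : ∀ i, IsWeightedHomogeneous (bideg g) (φ x i) (1, 1) := by
    intro i
    refine Fin.cases S.f_isWeightedHomogeneous (fun i => ?_) i
    change IsWeightedHomogeneous (bideg g) (C x⁻¹ * (S.F i x - S.f)) (1, 1)
    simpa using (isWeightedHomogeneous_C (bideg g) x⁻¹).mul
      ((hF i).sub S.f_isWeightedHomogeneous)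
  have hsum : monomial d 1 = ∑ i, φ x i * B i := by
    have e1 : co (∑ i, φ x i * B i) = co (monomial d 1) := by
      rw [← hc, Fintype.sum_prod_type, map_sum]
      refine Finset.sum_congr rfl fun i _ => ?_
      simp only [B, Finset.mul_sum, map_sum, Fintype.sum_prod_type, u, ← map_smul]
      refine Finset.sum_congr rfl fun a _ => Finset.sum_congr rfl fun j _ => ?_
      congr 1
      rw [smul_eq_C_mul]
      ring
    ext d'
    by_cases hd' : Finsupp.weight (bideg g) d' = (2, 2)
    · exact (congrFun e1 ⟨d', hd'⟩).symm
    · rw [(isWeightedHomogeneous_monomial (bideg g) d (1 : ℂ) hd).coeff_eq_zero d' hd']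
      exact ((IsWeightedHomogeneous.sum _ _ _ fun i _ => (hφ i).mul (hB i)).coeff_eq_zero
        d' hd').symm
  -- Coefficients of the difference quotients are rewritten as coefficients of `f` and the `F_i(·,
  -- x)`.
  refine ⟨Fin.cons (B 0 - ∑ i : Fin g, C x⁻¹ * B i.succ) fun i => C x⁻¹ * B i.succ,
    fun i => ?_, ?_⟩
  · have h1 : ∀ i : Fin g, IsWeightedHomogeneous (bideg g) (C x⁻¹ * B i.succ) (1, 1) := fun i => by
      simpa using (isWeightedHomogeneous_C (bideg g) x⁻¹).mul (hB i.succ)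
    refine Fin.cases ?_ h1 i
    exact (hB 0).sub (IsWeightedHomogeneous.sum _ _ _ fun i _ => h1 i)
  · rw [hsum, Fin.sum_univ_succ, Fin.sum_univ_succ]
    simp only [φ, forms, Fin.cons_zero, Fin.cons_succ, mul_sub, Finset.mul_sum, sub_mul,
      Finset.sum_sub_distrib]
    have e2 : ∑ i, C x⁻¹ * S.f * B (Fin.succ i) = ∑ i, S.f * (C x⁻¹ * B (Fin.succ i)) :=
      Finset.sum_congr rfl fun i _ => by ring
    have e3 : ∑ i, C x⁻¹ * S.F i x * B (Fin.succ i) = ∑ i, S.F i x * (C x⁻¹ * B (Fin.succ i)) :=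
      Finset.sum_congr rfl fun i _ => by ring
    rw [e2, e3]
    ring

end Data
end RationalDBA
end

/-! ### Dimensions, and the operators on numerators -/

noncomputable section

namespace RationalDBA

open MvPolynomial Topology

section Dimension

variable {g : ℕ} (F : Type*) [Field F]

theorem card_degree_eq (σ : Type*) [Fintype σ] (k : ℕ) :
    Nat.card {d : σ →₀ ℕ | d.degree = k} = (Fintype.card σ + k - 1).choose k := by
  classical
  rw [← Finset.card_univ, ← Finset.card_finsuppAntidiag_nat_eq_choose, Nat.card_coe_set_eq,
    ← Set.ncard_coe_finset]
  congr 1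
  ext d
  simp [Finset.mem_finsuppAntidiag, Finsupp.degree_eq_sum]

theorem card_weight_eq (k : ℕ) :
    Nat.card {d : Coord g →₀ ℕ | Finsupp.weight (bideg g) d = (k, k)} =
      (k + 1) * (g + k - 1).choose k := by
  have e : {d : Coord g →₀ ℕ | Finsupp.weight (bideg g) d = (k, k)} ≃
      {d : Fin 2 →₀ ℕ | d.degree = k} × {d : Fin g →₀ ℕ | d.degree = k} :=
    (Equiv.subtypeEquiv Finsupp.sumFinsuppEquivProdFinsupp
      (q := fun x => x.1.degree = k ∧ x.2.degree = k) (fun d => by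
        simp [weight_bideg, Finsupp.degree_eq_sum])).trans
      (Equiv.subtypeProdEquivProd (p := fun d : Fin 2 →₀ ℕ => d.degree = k)
        (q := fun d : Fin g →₀ ℕ => d.degree = k))
  rw [Nat.card_congr e, Nat.card_prod, card_degree_eq, card_degree_eq]
  simp only [Fintype.card_fin]
  congr 1
  rw [show 2 + k - 1 = k + 1 by omega, Nat.choose_succ_self_right]

theorem finrank_weightedHomogeneousSubmodule (k : ℕ) :
    Module.finrank F (weightedHomogeneousSubmodule F (bideg g) (k, k)) =
      (k + 1) * (g + k - 1).choose k := by
  rw [weightedHomogeneousSubmodule_eq_finsupp_supported, ← card_weight_eq]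
  exact Module.finrank_eq_nat_card_basis
    (basisRestrictSupport F {d | Finsupp.weight (bideg g) d = (k, k)})

instance finite_bideg (k : ℕ) :
    Module.Finite F (weightedHomogeneousSubmodule F (bideg g) (k, k)) := by
  rw [weightedHomogeneousSubmodule_eq_finsupp_supported]
  have : Finite {d : Coord g →₀ ℕ | Finsupp.weight (bideg g) d = (k, k)} :=
    Data.finite_weight g (k, k)
  exact Module.Finite.of_basis
    (basisRestrictSupport F {d | Finsupp.weight (bideg g) d = (k, k)})

theorem finrank_homogeneousSubmodule (k : ℕ) :
    Module.finrank F (homogeneousSubmodule (Fin g) F k) = (g + k - 1).choose k := by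
  rw [homogeneousSubmodule_eq_finsupp_supported]
  refine (Module.finrank_eq_nat_card_basis
    (basisRestrictSupport F {d : Fin g →₀ ℕ | d.degree = k})).trans ?_
  rw [card_degree_eq, Fintype.card_fin]

end Dimension

namespace Data

variable {g : ℕ} (S : Data g)

instance finite_W {F : Type} [Field F] [Algebra ℂ F] (lam : F) (k : ℕ) :
    Module.Finite F (S.W lam k) :=
  Submodule.finiteDimensional_of_le inf_le_left

/-- Rank-nullity: for `k ≥ 1` the gluing map is onto the forms of degree `k` in `t`, which lowers
the factor `k + 1` to `k`. -/
theorem finrank_W {F : Type} [Field F] [Algebra ℂ F] (lam : F) {k : ℕ} (hk : 1 ≤ k) :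
    Module.finrank F (S.W lam k) = k * (g + k - 1).choose k := by
  set p := weightedHomogeneousSubmodule F (bideg g) (k, k)
  have h := LinearMap.finrank_range_add_finrank_ker ((S.glue lam k).domRestrict p)
  have h1 : LinearMap.range ((S.glue lam k).domRestrict p) = homogeneousSubmodule (Fin g) F k := by
    ext w
    constructor
    · rintro ⟨H, rfl⟩
      exact S.glue_isHomogeneous lam H.2
    · intro hw
      obtain ⟨H, hH, hHw⟩ := S.exists_glue_eq (lam := lam) (by omega) hw
      exact ⟨⟨H, hH⟩, hHw⟩
  have h2 : Module.finrank F (LinearMap.ker ((S.glue lam k).domRestrict p)) =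
      Module.finrank F (S.W lam k) := by
    rw [← Submodule.finrank_map_subtype_eq, LinearMap.ker_domRestrict, Submodule.map_comap_subtype]
    rfl
  rw [h1, h2, finrank_homogeneousSubmodule, finrank_weightedHomogeneousSubmodule] at h
  linarith

/-- The values of the parameter for which the construction of a free basis works. -/
structure Good (x : ℂ) : Prop where
  ne_zero : x ≠ 0
  generate : ∀ d : Coord g →₀ ℕ,
    Finsupp.weight (bideg g) d = (2, 2) → ∃ G : Fin (g + 1) → MvPolynomial (Coord g) ℂ,
      (∀ i, IsWeightedHomogeneous (bideg g) (G i) (1, 1)) ∧ monomial d 1 = ∑ i, S.forms x i * G i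
  rest_ne : ∀ i, S.rest₂ ℂ (S.F i x) ≠ 0

theorem eventually_good : ∀ᶠ x in 𝓝[≠] (0 : ℂ), S.Good x := by
  have h : ∀ i, ∀ᶠ x in 𝓝[≠] (0 : ℂ), S.rest₂ ℂ (S.F i x) ≠ 0 := by
    intro i
    have ht : Filter.Tendsto (fun x => eval (Sum.elim S.p₂ (S.P (S.v i))) (S.F i x)) (𝓝 0)
        (𝓝 (eval (Sum.elim S.p₂ (S.P (S.v i))) (S.F i 0))) := by
      simp only [F, eval_bilin]
      exact tendsto_finsetSum _ fun k _ => ((((S.γ_diff i k).continuousAt.tendsto).mul_const _).add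
        (((S.δ_diff i k).continuousAt.tendsto).mul_const _)).mul_const _
    have hne : eval (Sum.elim S.p₂ (S.P (S.v i))) (S.F i 0) ≠ 0 := by
      rw [F_zero]
      intro h
      apply S.f_v_ne i
      change eval _ S.f = 0
      rw [f_glue, h, mul_zero]
    filter_upwards [(ht.eventually_ne hne).filter_mono nhdsWithin_le_nhds] with x hx h0
    rw [← eval_rest₂, h0, map_zero] at hx
    exact hx rfl
  filter_upwards [S.eventually_generate, Filter.eventually_all.mpr h, self_mem_nhdsWithin] with x h1 h2 h3
  exact ⟨h3, h1, h2⟩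

theorem rest₁_bilin (a b : Fin g → ℂ) : S.rest₁ ℂ (bilin a b) =
    ∑ k, C (a k * S.p₁ 0 + b k * S.p₁ 1) * X k := by
  apply MvPolynomial.funext
  intro t
  rw [eval_rest₁, eval_bilin, map_sum]
  simp

theorem forms_isWeightedHomogeneous (x : ℂ) (i : Fin (g + 1)) :
    IsWeightedHomogeneous (bideg g) (S.forms x i) (1, 1) := by
  refine Fin.cases S.f_isWeightedHomogeneous (fun i => ?_) i
  exact bilin_isWeightedHomogeneous _ _

/-- The restrictions to `p₁` span the linear forms because they have no common zero `v ≠ 0`: a form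
of bidegree `(2, 2)` restricting to `t_j²` is a combination of the given forms, so `v_j² = 0` at a
common zero. -/
theorem exists_matrix {x : ℂ} (hx : S.Good x) :
    ∃ (N : Matrix (Fin (g + 1)) (Fin g) ℂ) (M : Matrix (Fin g) (Fin (g + 1)) ℂ),
      (∀ i, S.rest₁ ℂ (S.forms x i) = ∑ j, C (N i j) * X j) ∧ M * N = 1 := by
  have hN : ∀ i, ∃ N : Fin g → ℂ, S.rest₁ ℂ (S.forms x i) = ∑ j, C (N j) * X j := by
    refine Fin.cases ?_ fun i => ?_
    · exact ⟨_, S.rest₁_bilin _ _⟩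
    · exact ⟨_, S.rest₁_bilin _ _⟩
  choose N hN using hN
  have hinj : LinearMap.ker (Matrix.toLin' (Matrix.of N)) = ⊥ := by
    rw [LinearMap.ker_eq_bot']
    intro v hv
    ext j
    have hH : IsWeightedHomogeneous (bideg g)
        (S.form₁ ℂ * S.form₁ ℂ * (X (Sum.inr j) * X (Sum.inr j))) (1 + 1, 1 + 1) := by
      have := ((S.form₁_isWeightedHomogeneous ℂ).mul (S.form₁_isWeightedHomogeneous ℂ)).mul
        ((isWeightedHomogeneous_X ℂ (bideg g) (Sum.inr j)).mul
          (isWeightedHomogeneous_X ℂ (bideg g) (Sum.inr j)))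
      simpa [bideg] using this
    obtain ⟨G, -, hG⟩ := exists_sum_mul_of_two hx.generate le_rfl hH
    have h1 := congrArg (fun p => eval v (S.rest₁ ℂ p)) hG
    simp only [map_mul, map_sum, rest₁_form₁, hN, eval_C, eval_X] at h1
    have h2 : ∀ i, ∑ j, N i j * v j = 0 := fun i => congrFun hv i
    simp only [h2, zero_mul, Finset.sum_const_zero, map_one, one_mul] at h1
    rw [rest₁, aeval_X, Sum.elim_inr, eval_X] at h1
    simpa using h1
  obtain ⟨G, hG⟩ := LinearMap.exists_leftInverse_of_injective _ hinj
  refine ⟨Matrix.of N, LinearMap.toMatrix' G, hN, ?_⟩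
  have := congrArg LinearMap.toMatrix' hG
  rwa [LinearMap.toMatrix'_comp, LinearMap.toMatrix'_toLin', LinearMap.toMatrix'_id] at this

/-- The forms `f, F_1(·, x), …, F_g(·, x)` over `K`. -/
def formsK (x : ℂ) (i : Fin (g + 1)) : MvPolynomial (Coord g) K :=
  map (algebraMap ℂ K) (S.forms x i)

/-- The exponents of the multipliers of `f, F_1(·, x), …, F_g(·, x)`. -/
def formExp (x : ℂ) : Fin (g + 1) → ℂ := Fin.cons 0 fun _ => x

theorem map_isWeightedHomogeneous {R R' : Type*} [CommSemiring R] [CommSemiring R'] (φ : R →+* R')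
    {p : MvPolynomial (Coord g) R} {n : ℕ × ℕ} (hp : IsWeightedHomogeneous (bideg g) p n) :
    IsWeightedHomogeneous (bideg g) (map φ p) n := by
  intro d hd
  apply hp
  rintro h0
  apply hd
  rw [coeff_map, h0, map_zero]

theorem formsK_isWeightedHomogeneous (x : ℂ) (i : Fin (g + 1)) :
    IsWeightedHomogeneous (bideg g) (S.formsK x i) (1, 1) :=
  map_isWeightedHomogeneous _ (S.forms_isWeightedHomogeneous x i)

theorem rest₁_forms (x : ℂ) (i : Fin (g + 1)) : S.rest₁ ℂ (S.forms x i) =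
    C (S.A * Complex.exp (formExp x i)) * S.rest₂ ℂ (S.forms x i) := by
  refine Fin.cases ?_ (fun i => ?_) i
  · simpa [forms, formExp] using S.rest₁_f
  · exact S.rest₁_F i x

theorem rest₁_formsK (x : ℂ) (i : Fin (g + 1)) : S.rest₁ K (S.formsK x i) =
    C (algebraMap ℂ K S.A * algebraMap ℂ K (Complex.exp (formExp x i))) *
      S.rest₂ K (S.formsK x i) := by
  rw [formsK, ← map_rest₁_complex, ← map_rest₂_complex, rest₁_forms, map_mul, map_C, map_mul]

/-- The multiplier `Λ E⁻¹`. -/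
def lam : K := algebraMap ℂ K S.Lam * RatFunc.X⁻¹

theorem lam_ne : S.lam ≠ 0 :=
  mul_ne_zero ((map_ne_zero _).mpr S.Lam_ne) (inv_ne_zero RatFunc.X_ne_zero)

theorem expScale_lam (s : ℂ) :
    expScale s S.lam = S.lam / algebraMap ℂ K (Complex.exp s) := by
  rw [lam, map_mul, AlgHom.commutes, map_inv₀, expScale_X, mul_inv]
  ring

theorem lam_ne_algebraMap (c : ℂ) : S.lam ≠ algebraMap ℂ K c := by
  intro h
  -- The substitution `E ↦ -E` fixes constants but changes the sign of `Λ E⁻¹`.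
  have h1 := S.expScale_lam (Real.pi * Complex.I)
  rw [h, AlgHom.commutes, ← h, eq_div_iff (by simp)] at h1
  have h2 := mul_left_cancel₀ S.lam_ne (h1.trans (mul_one _).symm)
  rw [← map_one (algebraMap ℂ K)] at h2
  have h3 := (algebraMap ℂ K).injective h2
  rw [Complex.exp_pi_mul_I] at h3
  norm_num at h3

theorem map_expScale_glue (s : ℂ) (k : ℕ) (l : K) (H : MvPolynomial (Coord g) K) :
    S.glue (expScale s l) k (map (expScale s : K →+* K) H) =
      map (expScale s : K →+* K) (S.glue l k H) := by
  rw [glue_apply, glue_apply, map_sub, map_mul (map (expScale s : K →+* K)), map_rest₁, map_rest₂,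
    map_C, RingHom.coe_coe, map_mul (expScale s), map_pow (expScale s), AlgHom.commutes]

theorem map_expScale_mem_W (s : ℂ) {k : ℕ} {l : K} {H : MvPolynomial (Coord g) K}
    (hH : H ∈ S.W l k) : map (expScale s : K →+* K) H ∈ S.W (expScale s l) k := by
  refine ⟨map_isWeightedHomogeneous _ hH.1, ?_⟩
  change S.glue _ _ _ = 0
  rw [map_expScale_glue, show S.glue l k H = 0 from hH.2, map_zero]

theorem map_expScale_map (s s' : ℂ) (H : MvPolynomial (Coord g) K) :
    map (expScale s : K →+* K) (map (expScale s' : K →+* K) H) =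
      map (expScale (s + s') : K →+* K) H := by
  rw [map_map, expScale_add]
  rfl

theorem map_expScale_zero (H : MvPolynomial (Coord g) K) :
    map (expScale 0 : K →+* K) H = H := by
  rw [expScale_zero]
  exact map_id H

theorem map_expScale_formsK (s x : ℂ) (i : Fin (g + 1)) :
    map (expScale s : K →+* K) (S.formsK x i) = S.formsK x i := by
  rw [formsK, map_map]
  congr 2
  exact RingHom.ext (expScale s).commutes

/-- The action of `1, T_1, …, T_g` on numerators. -/
def op (x : ℂ) (i : Fin (g + 1)) (H : MvPolynomial (Coord g) K) : MvPolynomial (Coord g) K :=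
  S.formsK x i * map (expScale (formExp x i) : K →+* K) H

/-- Scaling `E` divides the multiplier `Λ E⁻¹` by exactly the exponential that the form contributes.
-/
theorem op_mem_W (x : ℂ) (i : Fin (g + 1)) {k : ℕ} {H : MvPolynomial (Coord g) K}
    (hH : H ∈ S.W S.lam k) : S.op x i H ∈ S.W S.lam (k + 1) := by
  have h := S.map_expScale_mem_W (formExp x i) hH
  refine ⟨?_, ?_⟩
  · have := (S.formsK_isWeightedHomogeneous x i).mul h.1
    rwa [Prod.mk_add_mk, add_comm] at this
  · change S.glue _ _ (S.formsK x i * _) = 0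
    rw [S.glue_mul ((map_ne_zero _).mpr (Complex.exp_ne_zero _)) (S.rest₁_formsK x i),
      ← expScale_lam, show S.glue _ k _ = 0 from h.2, mul_zero]

theorem exists_sum_op {x : ℂ} (hx : S.Good x) {k : ℕ} (hk : 1 ≤ k)
    {H : MvPolynomial (Coord g) K} (hH : H ∈ S.W S.lam (k + 1)) :
    ∃ G : Fin (g + 1) → MvPolynomial (Coord g) K, (∀ i, G i ∈ S.W S.lam k) ∧
      H = ∑ i, S.op x i (G i) := by
  obtain ⟨N, M, hN, hMN⟩ := S.exists_matrix hx
  have : CharZero K := charZero_of_injective_algebraMap (algebraMap ℂ K).injective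
  obtain ⟨G, hG, hH⟩ := S.exists_sum_mul_of_mem_W (F := K) (fs := S.formsK x)
    (μ := fun i => algebraMap ℂ K (Complex.exp (formExp x i)))
    (fun i => (map_ne_zero _).mpr (Complex.exp_ne_zero _))
    (S.formsK_isWeightedHomogeneous x) (S.rest₁_formsK x)
    (N := N.map (algebraMap ℂ K)) (M := M.map (algebraMap ℂ K))
    (fun i => by
      rw [formsK, ← map_rest₁_complex, hN, map_sum]
      exact Finset.sum_congr rfl fun j _ => by rw [map_mul, map_C, map_X, Matrix.map_apply])
    (by rw [← Matrix.map_mul, hMN, Matrix.map_one _ (map_zero _) (map_one _)])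
    (fun d hd => by
      obtain ⟨G, hG, h⟩ := hx.generate d hd
      refine ⟨fun i => map (algebraMap ℂ K) (G i), fun i => map_isWeightedHomogeneous _ (hG i), ?_⟩
      have := congrArg (map (algebraMap ℂ K)) h
      simpa only [map_monomial, map_one, map_sum, map_mul, formsK] using this)
    (lam := S.lam) (fun i j h => by
      rw [div_div, div_eq_one_iff_eq (by simp [Complex.exp_ne_zero]), ← map_mul] at h
      exact S.lam_ne_algebraMap _ h) hk hH
  -- The decomposition over `K` has coefficients glued with multiplier `lam / μᵢ`; scaling `E` back
  -- restores `lam` and turns multiplication by the form into `op`.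
  refine ⟨fun i => map (expScale (-formExp x i) : K →+* K) (G i), fun i => ?_, ?_⟩
  · have := S.map_expScale_mem_W (-formExp x i) (hG i)
    rwa [← expScale_lam, ← AlgHom.comp_apply, ← expScale_add, neg_add_cancel, expScale_zero,
      AlgHom.id_apply] at this
  · rw [hH]
    refine Finset.sum_congr rfl fun i _ => ?_
    rw [op, map_expScale_map, add_neg_cancel, map_expScale_zero]

theorem W_zero : S.W S.lam 0 = ⊥ := by
  rw [eq_bot_iff]
  intro H hH
  obtain ⟨c, rfl⟩ : ∃ c, H = C c := by
    refine ⟨coeff 0 H, ?_⟩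
    ext d
    rw [coeff_C]
    split_ifs with h
    · rw [h]
    · by_contra h0
      have := hH.1 h0
      rw [weight_bideg, Prod.mk.injEq, Finset.sum_eq_zero_iff, Finset.sum_eq_zero_iff] at this
      apply h
      ext i
      rcases i with i | i
      · exact (this.1 i (Finset.mem_univ _)).symm
      · exact (this.2 i (Finset.mem_univ _)).symm
  have h : S.glue S.lam 0 (C c) = 0 := hH.2
  rw [glue_apply, algHom_C, algHom_C, algebraMap_eq, ← map_mul, ← map_sub, C_eq_zero, pow_zero,
    one_mul] at h
  have h1 : (1 - S.lam) * c = 0 := by linear_combination h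
  rcases mul_eq_zero.mp h1 with h2 | h2
  · exact absurd (sub_eq_zero.mp h2).symm (by simpa using S.lam_ne_algebraMap 1)
  · rw [h2, map_zero]; exact Submodule.zero_mem _

/-- The product of the operators `op` with multiplicities `a`. -/
def opPow (x : ℂ) (a : Fin (g + 1) →₀ ℕ) (H : MvPolynomial (Coord g) K) :
    MvPolynomial (Coord g) K :=
  (∏ i, S.formsK x i ^ a i) * map (expScale (∑ i, a i * formExp x i) : K →+* K) H

theorem opPow_zero (x : ℂ) (H : MvPolynomial (Coord g) K) : S.opPow x 0 H = H := by
  simp [opPow, map_expScale_zero]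

theorem op_smul (x : ℂ) (i : Fin (g + 1)) (r : K) (H : MvPolynomial (Coord g) K) :
    S.op x i (r • H) = expScale (formExp x i) r • S.op x i H := by
  rw [op, op, smul_eq_C_mul, smul_eq_C_mul, map_mul, map_C]
  exact mul_left_comm _ _ _

theorem op_add (x : ℂ) (i : Fin (g + 1)) (H H' : MvPolynomial (Coord g) K) :
    S.op x i (H + H') = S.op x i H + S.op x i H' := by
  rw [op, op, op, map_add, mul_add]

theorem op_opPow (x : ℂ) (i : Fin (g + 1)) (a : Fin (g + 1) →₀ ℕ) (H : MvPolynomial (Coord g) K) :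
    S.op x i (S.opPow x a H) = S.opPow x (a + Finsupp.single i 1) H := by
  rw [op, opPow, opPow, map_mul, map_prod, map_expScale_map, ← mul_assoc]
  congr 1
  · simp only [map_pow, map_expScale_formsK, Finsupp.add_apply, pow_add, Finset.prod_mul_distrib]
    rw [mul_comm, Finset.prod_eq_single (f := fun j => S.formsK x j ^ (Finsupp.single i 1) j) i]
    · simp
    · intro j _ hj
      simp [hj.symm]
    · simp
  · congr 3
    simp only [Finsupp.add_apply, Nat.cast_add, add_mul, Finset.sum_add_distrib]
    rw [add_comm, Finset.sum_eq_single (f := fun j => ((Finsupp.single i 1 j : ℕ) : ℂ) *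
      formExp x j) i]
    · simp
    · intro j _ hj
      simp [hj.symm]
    · simp

theorem exists_eq_add_single {σ : Type*} {a : σ →₀ ℕ} {k : ℕ} (ha : a.degree = k + 1) :
    ∃ i b, a = b + Finsupp.single i 1 ∧ b.degree = k := by
  classical
  have hne : a ≠ 0 := by rintro rfl; simp at ha
  obtain ⟨i, hi⟩ := Finsupp.ne_iff.mp hne
  have hle : Finsupp.single i 1 ≤ a := by
    rw [Finsupp.single_le_iff]
    exact Nat.one_le_iff_ne_zero.mpr hi
  obtain ⟨b, rfl⟩ := exists_add_of_le hle
  refine ⟨i, b, add_comm _ _, ?_⟩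
  rw [map_add, Finsupp.degree_single] at ha
  omega

theorem opPow_mem_W (x : ℂ) {H : MvPolynomial (Coord g) K} (hH : H ∈ S.W S.lam 1) {k : ℕ}
    {a : Fin (g + 1) →₀ ℕ} (ha : a.degree = k) : S.opPow x a H ∈ S.W S.lam (k + 1) := by
  induction k generalizing a with
  | zero =>
    rw [Finsupp.degree_eq_zero_iff] at ha
    rwa [ha, opPow_zero]
  | succ k ih =>
    obtain ⟨i, b, rfl, hb⟩ := exists_eq_add_single ha
    rw [← op_opPow]
    exact S.op_mem_W x i (ih hb)

/-- By `exists_sum_op` each level is reached from the previous one by the operators; they are only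
semilinear over `K`, which is enough to carry spanning families along. -/
theorem span_opPow {x : ℂ} (hx : S.Good x) {β : Fin g → MvPolynomial (Coord g) K}
    (hβ : Submodule.span K (Set.range β) = S.W S.lam 1) (k : ℕ) :
    Submodule.span K (Set.range fun p : {a : Fin (g + 1) →₀ ℕ // a.degree = k} × Fin g =>
      S.opPow x p.1.1 (β p.2)) = S.W S.lam (k + 1) := by
  apply le_antisymm
  · rw [Submodule.span_le]
    rintro _ ⟨⟨a, j⟩, rfl⟩
    exact S.opPow_mem_W x (hβ ▸ Submodule.subset_span ⟨j, rfl⟩) a.2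
  · induction k with
    | zero =>
      rw [zero_add, ← hβ, Submodule.span_le]
      rintro _ ⟨j, rfl⟩
      exact Submodule.subset_span ⟨⟨⟨0, by simp⟩, j⟩, S.opPow_zero x _⟩
    | succ k ih =>
      intro H hH
      obtain ⟨G, hG, rfl⟩ := S.exists_sum_op hx (by omega) hH
      refine Submodule.sum_mem _ fun i _ => ?_
      have h := ih (hG i)
      generalize G i = y at h
      induction h using Submodule.span_induction with
      | mem _ h =>
        obtain ⟨⟨a, j⟩, rfl⟩ := h
        refine Submodule.subset_span ⟨⟨⟨a.1 + Finsupp.single i 1, ?_⟩, j⟩, ?_⟩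
        · rw [map_add, Finsupp.degree_single, a.2]
        · exact (S.op_opPow x i a.1 (β j)).symm
      | zero => simp [op]
      | add y z _ _ hy hz => rw [op_add]; exact add_mem hy hz
      | smul r y _ hy => rw [op_smul]; exact Submodule.smul_mem _ _ hy

theorem exists_basis_W_one :
    ∃ β : Fin g → MvPolynomial (Coord g) K, Submodule.span K (Set.range β) = S.W S.lam 1 := by
  have h : Module.finrank K (S.W S.lam 1) = g := by
    rw [S.finrank_W S.lam le_rfl]
    simp
  let b := Module.finBasisOfFinrankEq K (S.W S.lam 1) h
  refine ⟨fun i => b i, ?_⟩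
  have := congrArg (Submodule.map (S.W S.lam 1).subtype) b.span_eq
  rwa [Submodule.map_span, Submodule.map_subtype_top, ← Set.range_comp] at this

/-- The spanning family has `g C(g + k, k)` members, and this equals the dimension `(k + 1) C(g + k,
k + 1)` of its span. -/
theorem linearIndependent_opPow {x : ℂ} (hx : S.Good x) {β : Fin g → MvPolynomial (Coord g) K}
    (hβ : Submodule.span K (Set.range β) = S.W S.lam 1) (k : ℕ) :
    LinearIndependent K (fun p : {a : Fin (g + 1) →₀ ℕ // a.degree = k} × Fin g =>
      S.opPow x p.1.1 (β p.2)) := by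
  have hcard := card_degree_eq (Fin (g + 1)) k
  have hfin : Finite {a : Fin (g + 1) →₀ ℕ // a.degree = k} := by
    apply Nat.finite_of_card_ne_zero
    change Nat.card {d : Fin (g + 1) →₀ ℕ | d.degree = k} ≠ 0
    rw [hcard, Fintype.card_fin]
    exact (Nat.choose_pos (by omega)).ne'
  have := Fintype.ofFinite {a : Fin (g + 1) →₀ ℕ // a.degree = k}
  rw [linearIndependent_iff_card_eq_finrank_span, Set.finrank, S.span_opPow hx hβ k,
    S.finrank_W S.lam (by omega), Fintype.card_prod, ← Nat.card_eq_fintype_card,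
    Fintype.card_fin]
  change Nat.card {d : Fin (g + 1) →₀ ℕ | d.degree = k} * g = _
  rw [hcard, Fintype.card_fin]
  have := Nat.choose_succ_right_eq (g + k) k
  rw [Nat.add_sub_cancel] at this
  rw [show g + 1 + k - 1 = g + k by omega, show g + (k + 1) - 1 = g + k by omega, ← this]
  ring

end Data
end RationalDBA
end

/-! ### The Baker-Akhiezer module described by numerators at `n = 0` -/

noncomputable section

namespace RationalDBA

open MvPolynomial Topology

namespace Data

variable {g : ℕ} (S : Data g)

/-- The steps `h` for which `c̃ᵢ hᵢ = x` for all `i`. -/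
def steps (x : ℂ) : Fin g → ℂ := fun i => x / S.c i

theorem c_mul_steps (x : ℂ) (i : Fin g) : S.c i * S.steps x i = x :=
  mul_div_cancel₀ x (S.c_ne i)

theorem fi_steps (x : ℂ) (i : Fin g) : S.fi (S.steps x) i = S.F i x := by
  rw [fi_eq, c_mul_steps]

theorem exp_expo_steps (x : ℂ) (n : Fin g → ℤ) :
    Complex.exp (S.expo (S.steps x) n) = ∏ i, Complex.exp x ^ n i := by
  rw [expo, Complex.exp_sum]
  refine Finset.prod_congr rfl fun i _ => ?_
  rw [← Complex.exp_int_mul]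
  congr 1
  linear_combination (n i : ℂ) * S.c_mul_steps x i

/-- The function of `n` with numerator `H` at `n = 0`. -/
def Theta (x : ℂ) (k : ℕ) (H : MvPolynomial (Coord g) K) : DFun g := fun n =>
  S.expr (algebraMap (MvPolynomial (Coord g) K) (Phi g)) (S.steps x) k n
    (map (expScale (S.expo (S.steps x) n) : K →+* K) H)

theorem expr_add {L : Type} [Field L] (ρ : MvPolynomial (Coord g) K →+* L) (h : Fin g → ℂ) (k : ℕ)
    (n : Fin g → ℤ) (H H' : MvPolynomial (Coord g) K) :
    S.expr ρ h k n (H + H') = S.expr ρ h k n H + S.expr ρ h k n H' := by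
  rw [expr, expr, expr, map_add, add_div, add_mul]

theorem expr_C_mul {L : Type} [Field L] (ρ : MvPolynomial (Coord g) K →+* L) (h : Fin g → ℂ)
    (k : ℕ) (n : Fin g → ℤ) (r : K) (H : MvPolynomial (Coord g) K) :
    S.expr ρ h k n (C r * H) = ρ (C r) * S.expr ρ h k n H := by
  have := S.expr_mul_mul ρ h 0 k n (C r) H
  rwa [zero_add, pow_zero, div_one] at this

theorem Theta_add (x : ℂ) (k : ℕ) (H H' : MvPolynomial (Coord g) K) :
    S.Theta x k (H + H') = S.Theta x k H + S.Theta x k H' := by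
  ext1 n
  rw [Theta, map_add, expr_add]
  rfl

theorem Theta_zero (x : ℂ) (k : ℕ) : S.Theta x k 0 = 0 := by
  ext1 n
  rw [Theta, map_zero, expr, map_zero, zero_div, zero_mul]
  rfl

theorem Theta_smul (x : ℂ) (k : ℕ) (r : K) (H : MvPolynomial (Coord g) K) :
    S.Theta x k (r • H) = mulOp (S.hat (S.steps x) r) (S.Theta x k H) := by
  ext1 n
  rw [Theta, smul_eq_C_mul, map_mul, map_C, expr_C_mul]
  change _ = algebraMap K (Phi g) (S.hat (S.steps x) r n) * S.Theta x k H n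
  rw [hat_apply, IsScalarTower.algebraMap_apply K (MvPolynomial (Coord g) K) (Phi g)]
  rfl

theorem map_f_ne : map (algebraMap ℂ K) S.f ≠ 0 := by
  rw [Ne, map_eq_zero_iff _ (map_injective _ (algebraMap ℂ K).injective)]
  exact S.f_ne

theorem algebraMap_f_ne :
    algebraMap (MvPolynomial (Coord g) K) (Phi g) (map (algebraMap ℂ K) S.f) ≠ 0 := by
  rw [Ne, FaithfulSMul.algebraMap_eq_zero_iff]
  exact S.map_f_ne

variable {S} in
theorem Good.F_ne {x : ℂ} (hx : S.Good x) (i : Fin g) :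
    algebraMap (MvPolynomial (Coord g) K) (Phi g) (map (algebraMap ℂ K) (S.F i x)) ≠ 0 := by
  rw [Ne, FaithfulSMul.algebraMap_eq_zero_iff,
    map_eq_zero_iff _ (map_injective _ (algebraMap ℂ K).injective)]
  intro h
  apply hx.rest_ne i
  rw [h, map_zero]

/-- The operator with index `0` multiplies numerator and denominator by `f`; it is the inclusion of
one level in the next. -/
theorem Theta_op_zero (x : ℂ) (k : ℕ) (H : MvPolynomial (Coord g) K) :
    S.Theta x (k + 1) (S.op x 0 H) = S.Theta x k H := by
  ext1 n
  rw [Theta, Theta, op, map_mul, map_expScale_formsK, add_comm, expr_mul_mul,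
    show formExp x (0 : Fin (g + 1)) = 0 from rfl, map_expScale_zero, pow_one,
    show S.formsK x 0 = map (algebraMap ℂ K) S.f from rfl, div_self S.algebraMap_f_ne, one_mul]

theorem expo_add_single (x : ℂ) (n : Fin g → ℤ) (i : Fin g) :
    S.expo (S.steps x) (n + Pi.single i 1) = S.expo (S.steps x) n + x := by
  rw [expo_add, expo_single, c_mul_steps]

theorem shift_Theta {x : ℂ} (hx : S.Good x) (i : Fin g) (k : ℕ) (H : MvPolynomial (Coord g) K) :
    shift i (S.Theta x k H) = S.Theta x (k + 1) (S.op x i.succ H) := by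
  ext1 n
  change S.Theta x k H (n + Pi.single i 1) = _
  rw [Theta, Theta, op, map_mul, map_expScale_formsK, map_expScale_map, expo_add_single,
    add_comm k, expr_mul_mul, show formExp x i.succ = x from rfl, pow_one, expr, expr,
    show S.formsK x i.succ = map (algebraMap ℂ K) (S.F i x) from rfl]
  simp only [fi_steps]
  have h : ∀ j, (algebraMap (MvPolynomial (Coord g) K) (Phi g)
      (map (algebraMap ℂ K) (S.F j x)) / algebraMap (MvPolynomial (Coord g) K) (Phi g)
        (map (algebraMap ℂ K) S.f)) ≠ 0 := fun j => div_ne_zero (hx.F_ne j) S.algebraMap_f_ne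
  simp only [Pi.add_apply, zpow_add₀ (h _), Finset.prod_mul_distrib]
  rw [Finset.prod_eq_single (f := fun j => (algebraMap (MvPolynomial (Coord g) K) (Phi g)
      (map (algebraMap ℂ K) (S.F j x)) / algebraMap (MvPolynomial (Coord g) K) (Phi g)
        (map (algebraMap ℂ K) S.f)) ^ (Pi.single i 1 : Fin g → ℤ) j) i]
  · rw [Pi.single_eq_same, zpow_one]
    ring
  · intro j _ hj
    rw [Pi.single_eq_of_ne hj, zpow_zero]
  · simp

/-- Between the two sides `f ^ k` contributes `A ^ k` and the product of powers contributes `exp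
(expo n)`. Dividing `Λ E⁻¹` by this exponential is the scaling of `E` by `nh`. Negative powers
require the restrictions of the forms to be nonzero. -/
theorem expr_res_eq_iff (hg : 1 ≤ g) {x : ℂ} (hx : S.Good x) (k : ℕ) (n : Fin g → ℤ)
    (G : MvPolynomial (Coord g) K) :
    S.expr S.res₁ (S.steps x) k n G =
        algebraMap K (FractionRing (MvPolynomial (Fin g) K)) S.lam *
          S.expr S.res₂ (S.steps x) k n G ↔
      S.glue (expScale (S.expo (S.steps x) n) S.lam) k G = 0 := by
  let L := FractionRing (MvPolynomial (Fin g) K)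
  let r := algebraMap (MvPolynomial (Fin g) K) L
  have hr : Function.Injective r := IsFractionRing.injective _ _
  have hrC : ∀ c : K, r (C c) = algebraMap K L c := fun c =>
    (IsScalarTower.algebraMap_apply K (MvPolynomial (Fin g) K) L c).symm
  have hmap : ∀ p : MvPolynomial (Fin g) ℂ, p ≠ 0 → r (map (algebraMap ℂ K) p) ≠ 0 := by
    intro p hp h
    rw [map_eq_zero_iff r hr,
      map_eq_zero_iff _ (map_injective _ (algebraMap ℂ K).injective)] at h
    exact hp h
  set a : L := algebraMap K L (algebraMap ℂ K S.A) with ha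
  set e : L := algebraMap K L (algebraMap ℂ K (Complex.exp x)) with he
  set u : L := S.res₂ (map (algebraMap ℂ K) S.f) with hu
  have ha0 : a ≠ 0 := by simp [a, S.A_ne]
  have he0 : e ≠ 0 := by simp [e, Complex.exp_ne_zero]
  have hf2 : S.rest₂ ℂ S.f ≠ 0 := by
    intro h
    apply S.rest₁_f_ne hg
    rw [rest₁_f, h, mul_zero]
  have hu0 : u ≠ 0 := by
    rw [hu, res₂_apply, ← map_rest₂_complex]
    exact hmap _ hf2
  have hv0 : ∀ j, S.res₂ (map (algebraMap ℂ K) (S.F j x)) ≠ 0 := by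
    intro j
    rw [res₂_apply, ← map_rest₂_complex]
    exact hmap _ (hx.rest_ne j)
  have h1f : S.res₁ (map (algebraMap ℂ K) S.f) = a * u := by
    rw [hu, res₁_apply, res₂_apply, ← map_rest₁_complex, ← map_rest₂_complex, rest₁_f, map_mul,
      map_C, map_mul]
    congr 1
  have h1F : ∀ j, S.res₁ (map (algebraMap ℂ K) (S.F j x)) =
      a * e * S.res₂ (map (algebraMap ℂ K) (S.F j x)) := by
    intro j
    rw [res₁_apply, res₂_apply, ← map_rest₁_complex, ← map_rest₂_complex, rest₁_F, map_mul,
      map_C, map_mul]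
    congr 1
    rw [ha, he, ← map_mul, ← map_mul]
    exact hrC _
  have hE : ∏ j, e ^ n j =
      algebraMap K L (algebraMap ℂ K (Complex.exp (S.expo (S.steps x) n))) := by
    rw [exp_expo_steps, map_prod, map_prod]
    exact Finset.prod_congr rfl fun j _ => by rw [map_zpow₀, map_zpow₀]
  have hE0 : ∏ j, e ^ n j ≠ 0 := Finset.prod_ne_zero_iff.mpr fun j _ => zpow_ne_zero _ he0
  set V : L := ∏ j, (S.res₂ (map (algebraMap ℂ K) (S.F j x)) / u) ^ n j with hV
  have hV0 : V ≠ 0 := Finset.prod_ne_zero_iff.mpr fun j _ =>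
    zpow_ne_zero _ (div_ne_zero (hv0 j) hu0)
  have hV1 : ∏ j, (a * e * S.res₂ (map (algebraMap ℂ K) (S.F j x)) / (a * u)) ^ n j =
      (∏ j, e ^ n j) * V := by
    rw [hV, ← Finset.prod_mul_distrib]
    refine Finset.prod_congr rfl fun j _ => ?_
    rw [← mul_zpow, mul_assoc, mul_div_mul_left _ _ ha0, mul_div_assoc]
  have hglue : S.glue (expScale (S.expo (S.steps x) n) S.lam) k G = 0 ↔
      S.res₁ G = a ^ k * (algebraMap K L S.lam / ∏ j, e ^ n j) * S.res₂ G := by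
    have h : r (C (algebraMap ℂ K S.A ^ k *
        (S.lam / algebraMap ℂ K (Complex.exp (S.expo (S.steps x) n))))) =
        a ^ k * (algebraMap K L S.lam / ∏ j, e ^ n j) := by
      rw [hrC, map_mul, map_pow, map_div₀, hE]
    rw [glue_apply, sub_eq_zero, expScale_lam, res₁_apply, res₂_apply, ← h, ← map_mul]
    exact hr.eq_iff.symm
  rw [hglue]
  simp only [expr, fi_steps, h1f, h1F, hV1, ← hu, ← hV, mul_pow]
  field_simp
  rw [mul_right_comm]

/-- The gluing conditions for all `n` are scalings of the one at `n = 0`, so a single numerator in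
`W(k)` encodes the function. -/
theorem mem_Mhat_iff (hg : 1 ≤ g) {x : ℂ} (hx : S.Good x) {k : ℕ} {ψ : DFun g} :
    ψ ∈ S.Mhat (S.steps x) k ↔ ∃ H ∈ S.W S.lam k, S.Theta x k H = ψ := by
  constructor
  · rintro ⟨H, hH, hK, hψ, hres⟩
    rw [mem_Khat_iff] at hK
    refine ⟨H 0, ⟨hH 0, ?_⟩, ?_⟩
    · have := (S.expr_res_eq_iff hg hx k 0 (H 0)).mp (hres 0)
      rwa [expo_zero, expScale_zero] at this
    · ext1 n
      rw [hψ, hK n]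
      rfl
  · rintro ⟨H, hH, rfl⟩
    refine ⟨fun n => map (expScale (S.expo (S.steps x) n) : K →+* K) H,
      fun n => map_isWeightedHomogeneous _ hH.1, ?_, fun n => rfl, fun n => ?_⟩
    · rw [mem_Khat_iff]
      intro n
      rw [expo_zero, map_expScale_zero]
    · refine (S.expr_res_eq_iff hg hx k n _).mpr ?_
      exact (S.map_expScale_mem_W _ hH).2

theorem mulOp_mem_T (h : Fin g → ℂ) (r : K) : mulOp (S.hat h r) ∈ S.T h :=
  Algebra.subset_adjoin (Or.inl ⟨_, ⟨r, rfl⟩, rfl⟩)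

theorem shift_mem_T (h : Fin g → ℂ) (i : Fin g) : shift i ∈ S.T h :=
  Algebra.subset_adjoin (Or.inr ⟨i, rfl⟩)

theorem Mhat_mono (hg : 1 ≤ g) {x : ℂ} (hx : S.Good x) :
    Monotone (S.Mhat (S.steps x)) := by
  refine monotone_nat_of_le_succ fun k ψ hψ => ?_
  rw [S.mem_Mhat_iff hg hx] at hψ ⊢
  obtain ⟨H, hH, rfl⟩ := hψ
  exact ⟨_, S.op_mem_W x 0 hH, S.Theta_op_zero x k H⟩

theorem smul_mem_iUnion_Mhat (hg : 1 ≤ g) {x : ℂ} (hx : S.Good x) (D : S.T (S.steps x))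
    {ψ : DFun g} (hψ : ψ ∈ ⋃ k, S.Mhat (S.steps x) k) : D • ψ ∈ ⋃ k, S.Mhat (S.steps x) k := by
  obtain ⟨D, hD⟩ := D
  change D ψ ∈ _
  induction hD using Algebra.adjoin_induction generalizing ψ with
  | mem D hD =>
    obtain ⟨k, hψ⟩ := Set.mem_iUnion.mp hψ
    obtain ⟨H, hH, rfl⟩ := (S.mem_Mhat_iff hg hx).mp hψ
    rcases hD with ⟨_, ⟨r, rfl⟩, rfl⟩ | ⟨i, rfl⟩
    · exact Set.mem_iUnion.mpr ⟨k, (S.mem_Mhat_iff hg hx).mpr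
        ⟨r • H, Submodule.smul_mem _ _ hH, S.Theta_smul x k r H⟩⟩
    · exact Set.mem_iUnion.mpr ⟨k + 1, (S.mem_Mhat_iff hg hx).mpr
        ⟨_, S.op_mem_W x i.succ hH, (S.shift_Theta hx i k H).symm⟩⟩
  | algebraMap c =>
    obtain ⟨k, hψ⟩ := Set.mem_iUnion.mp hψ
    obtain ⟨H, hH, rfl⟩ := (S.mem_Mhat_iff hg hx).mp hψ
    refine Set.mem_iUnion.mpr ⟨k, (S.mem_Mhat_iff hg hx).mpr
      ⟨algebraMap ℂ K c • H, Submodule.smul_mem _ _ hH, ?_⟩⟩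
    rw [Theta_smul]
    ext1 n
    change algebraMap K (Phi g) (S.hat (S.steps x) (algebraMap ℂ K c) n) * _ = c • S.Theta x k H n
    rw [hat_apply, AlgHom.commutes, Algebra.smul_def, IsScalarTower.algebraMap_apply ℂ K (Phi g)]
  | add D D' _ _ hD hD' =>
    obtain ⟨k, h⟩ := Set.mem_iUnion.mp (hD hψ)
    obtain ⟨k', h'⟩ := Set.mem_iUnion.mp (hD' hψ)
    have h := S.Mhat_mono hg hx (le_max_left k k') h
    have h' := S.Mhat_mono hg hx (le_max_right k k') h'
    obtain ⟨H, hH, e⟩ := (S.mem_Mhat_iff hg hx).mp h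
    obtain ⟨H', hH', e'⟩ := (S.mem_Mhat_iff hg hx).mp h'
    refine Set.mem_iUnion.mpr ⟨max k k', (S.mem_Mhat_iff hg hx).mpr
      ⟨H + H', Submodule.add_mem _ hH hH', ?_⟩⟩
    rw [Theta_add, e, e']
    rfl
  | mul D D' _ _ hD hD' => exact hD (hD' hψ)

theorem add_mem_iUnion_Mhat (hg : 1 ≤ g) {x : ℂ} (hx : S.Good x) {ψ ψ' : DFun g}
    (hψ : ψ ∈ ⋃ k, S.Mhat (S.steps x) k) (hψ' : ψ' ∈ ⋃ k, S.Mhat (S.steps x) k) :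
    ψ + ψ' ∈ ⋃ k, S.Mhat (S.steps x) k := by
  obtain ⟨k, h⟩ := Set.mem_iUnion.mp hψ
  obtain ⟨k', h'⟩ := Set.mem_iUnion.mp hψ'
  obtain ⟨H, hH, e⟩ := (S.mem_Mhat_iff hg hx).mp (S.Mhat_mono hg hx (le_max_left k k') h)
  obtain ⟨H', hH', e'⟩ := (S.mem_Mhat_iff hg hx).mp (S.Mhat_mono hg hx (le_max_right k k') h')
  refine Set.mem_iUnion.mpr ⟨max k k', (S.mem_Mhat_iff hg hx).mpr
    ⟨H + H', Submodule.add_mem _ hH hH', ?_⟩⟩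
  rw [Theta_add, e, e']

theorem Theta_opPow_mem_span {x : ℂ} (hx : S.Good x) (β : Fin g → MvPolynomial (Coord g) K)
    (j : Fin g) {k : ℕ} {a : Fin (g + 1) →₀ ℕ} (ha : a.degree = k) :
    S.Theta x (k + 1) (S.opPow x a (β j)) ∈
      Submodule.span (S.T (S.steps x)) (Set.range fun j => S.Theta x 1 (β j)) := by
  induction k generalizing a with
  | zero =>
    rw [Finsupp.degree_eq_zero_iff] at ha
    rw [ha, opPow_zero]
    exact Submodule.subset_span ⟨j, rfl⟩
  | succ k ih =>
    obtain ⟨i, b, rfl, hb⟩ := exists_eq_add_single ha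
    rw [← op_opPow]
    refine Fin.cases ?_ (fun i => ?_) i
    · rw [Theta_op_zero]
      exact ih hb
    · rw [← S.shift_Theta hx]
      exact Submodule.smul_mem _ (⟨_, S.shift_mem_T _ i⟩ : S.T (S.steps x)) (ih hb)

theorem span_eq_iUnion_Mhat (hg : 1 ≤ g) {x : ℂ} (hx : S.Good x)
    {β : Fin g → MvPolynomial (Coord g) K}
    (hβ : Submodule.span K (Set.range β) = S.W S.lam 1) :
    (Submodule.span (S.T (S.steps x)) (Set.range fun j => S.Theta x 1 (β j)) : Set (DFun g)) =
      ⋃ k, S.Mhat (S.steps x) k := by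
  apply Set.Subset.antisymm
  · intro ψ hψ
    induction hψ using Submodule.span_induction with
    | mem _ h =>
      obtain ⟨j, rfl⟩ := h
      exact Set.mem_iUnion.mpr ⟨1, (S.mem_Mhat_iff hg hx).mpr
        ⟨β j, hβ ▸ Submodule.subset_span ⟨j, rfl⟩, rfl⟩⟩
    | zero => exact Set.mem_iUnion.mpr ⟨0, (S.mem_Mhat_iff hg hx).mpr
        ⟨0, Submodule.zero_mem _, S.Theta_zero x 0⟩⟩
    | add ψ ψ' _ _ h h' => exact S.add_mem_iUnion_Mhat hg hx h h'
    | smul D ψ _ h => exact S.smul_mem_iUnion_Mhat hg hx D h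
  · rw [Set.iUnion_subset_iff]
    rintro k _ hψ
    obtain ⟨H, hH, rfl⟩ := (S.mem_Mhat_iff hg hx).mp hψ
    rcases k with _ | k
    · rw [W_zero, Submodule.mem_bot] at hH
      rw [hH, Theta_zero]
      exact Submodule.zero_mem _
    · rw [← S.span_opPow hx hβ] at hH
      rw [SetLike.mem_coe]
      induction hH using Submodule.span_induction with
      | mem _ h =>
        obtain ⟨⟨a, j⟩, rfl⟩ := h
        exact S.Theta_opPow_mem_span hx β j a.2
      | zero => rw [Theta_zero]; exact Submodule.zero_mem _
      | add y z _ _ hy hz =>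
        rw [Theta_add]
        exact Submodule.add_mem _
          (hy ((S.mem_Mhat_iff hg hx).mpr ⟨y, S.span_opPow hx hβ k ▸ ‹_›, rfl⟩))
          (hz ((S.mem_Mhat_iff hg hx).mpr ⟨z, S.span_opPow hx hβ k ▸ ‹_›, rfl⟩))
      | smul r y _ hy =>
        rw [Theta_smul]
        exact Submodule.smul_mem _ (⟨_, S.mulOp_mem_T _ r⟩ : S.T (S.steps x))
          (hy ((S.mem_Mhat_iff hg hx).mpr ⟨y, S.span_opPow hx hβ k ▸ ‹_›, rfl⟩))

end Data
end RationalDBA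
end

/-! ### Linear independence over the difference operators -/

noncomputable section

namespace RationalDBA

open MvPolynomial Topology

namespace Data

variable {g : ℕ} (S : Data g)

/-- The product of the shifts with multiplicities `a`. -/
def shiftBy (a : Fin g →₀ ℕ) : Module.End ℂ (DFun g) :=
  LinearMap.funLeft ℂ (Phi g) (fun n => n + fun i => (a i : ℤ))

theorem shiftBy_apply (a : Fin g →₀ ℕ) (ψ : DFun g) (n : Fin g → ℤ) :
    shiftBy a ψ n = ψ (n + fun i => (a i : ℤ)) := rfl

theorem mulOp_apply (r : (Fin g → ℤ) → K) (ψ : DFun g) (n : Fin g → ℤ) :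
    mulOp r ψ n = algebraMap K (Phi g) (r n) * ψ n := rfl

theorem shiftBy_zero (ψ : DFun g) : shiftBy 0 ψ = ψ := by
  ext1 n
  rw [shiftBy_apply]
  congr 1
  ext i
  simp

theorem shift_shiftBy (i : Fin g) (a : Fin g →₀ ℕ) (ψ : DFun g) :
    shift i (shiftBy a ψ) = shiftBy (a + Finsupp.single i 1) ψ := by
  ext1 n
  change ψ (n + Pi.single i 1 + fun i => (a i : ℤ)) = ψ (n + _)
  congr 1
  ext j
  simp only [Pi.add_apply, Finsupp.add_apply, Nat.cast_add, Finsupp.single_apply, Pi.single_apply,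
    eq_comm (a := j)]
  push_cast
  ring

theorem mulOp_shiftBy_mul (h : Fin g → ℂ) (r s : K) (a b : Fin g →₀ ℕ) :
    (mulOp (S.hat h r) * shiftBy a) * (mulOp (S.hat h s) * shiftBy b) =
      mulOp (S.hat h (r * expScale (S.expo h fun i => (a i : ℤ)) s)) * shiftBy (a + b) := by
  refine LinearMap.ext fun ψ => ?_
  ext1 n
  simp only [Module.End.mul_apply, mulOp_apply, shiftBy_apply, hat_apply]
  rw [expo_add, expScale_add, map_mul, map_mul, ← mul_assoc, AlgHom.comp_apply]
  congr 2
  ext i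
  simp [add_assoc]

/-- Normal form with coefficients on the left: a shift passes a coefficient at the cost of scaling
`E` in it, so the operators `r̂ T^a` are closed under products. -/
theorem exists_finsupp_of_mem_T {h : Fin g → ℂ} {D : Module.End ℂ (DFun g)} (hD : D ∈ S.T h) :
    ∃ c : (Fin g →₀ ℕ) →₀ K, D = c.sum fun a r => mulOp (S.hat h r) * shiftBy a := by
  have hz : ∀ a : Fin g →₀ ℕ, mulOp (S.hat h 0) * shiftBy a = 0 := by
    intro a
    refine LinearMap.ext fun ψ => ?_
    ext1 n
    simp [mulOp_apply, hat_apply]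
  have hadd : ∀ (a : Fin g →₀ ℕ) (r s : K), mulOp (S.hat h (r + s)) * shiftBy a =
      mulOp (S.hat h r) * shiftBy a + mulOp (S.hat h s) * shiftBy a := by
    intro a r s
    refine LinearMap.ext fun ψ => ?_
    ext1 n
    simp [mulOp_apply, hat_apply, add_mul]
  have h1 : (mulOp (S.hat h 1) : Module.End ℂ (DFun g)) = 1 := by
    refine LinearMap.ext fun ψ => ?_
    ext1 n
    simp [mulOp_apply, hat_apply]
  have h0 : (shiftBy 0 : Module.End ℂ (DFun g)) = 1 := LinearMap.ext shiftBy_zero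
  have hcl : ∀ D ∈ Submonoid.closure (mulOp '' S.Khat h ∪ Set.range shift),
      ∃ (r : K) (a : Fin g →₀ ℕ), D = mulOp (S.hat h r) * shiftBy a := by
    intro D hD
    induction hD using Submonoid.closure_induction with
    | mem D hD =>
      rcases hD with ⟨_, ⟨r, rfl⟩, rfl⟩ | ⟨i, rfl⟩
      · exact ⟨r, 0, by rw [h0, mul_one]⟩
      · refine ⟨1, Finsupp.single i 1, ?_⟩
        rw [h1, one_mul, ← zero_add (Finsupp.single i 1)]
        refine LinearMap.ext fun ψ => ?_
        rw [← shift_shiftBy, shiftBy_zero]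
    | one => exact ⟨1, 0, by rw [h0, h1, mul_one]⟩
    | mul D D' _ _ hD hD' =>
      obtain ⟨r, a, rfl⟩ := hD
      obtain ⟨s, b, rfl⟩ := hD'
      exact ⟨_, _, S.mulOp_shiftBy_mul h r s a b⟩
  have hD' : D ∈ Submodule.span ℂ
      (Submonoid.closure (mulOp '' S.Khat h ∪ Set.range shift) : Set (Module.End ℂ (DFun g))) := by
    rw [← Algebra.adjoin_eq_span]
    exact hD
  clear hD
  induction hD' using Submodule.span_induction with
  | mem D hmem =>
    obtain ⟨r, a, rfl⟩ := hcl D hmem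
    exact ⟨Finsupp.single a r, by rw [Finsupp.sum_single_index (hz a)]⟩
  | zero => exact ⟨0, by rw [Finsupp.sum_zero_index]⟩
  | add D D' _ _ hD hD' =>
    obtain ⟨c, rfl⟩ := hD
    obtain ⟨c', rfl⟩ := hD'
    exact ⟨c + c', by rw [Finsupp.sum_add_index' hz hadd]⟩
  | smul z D _ hD =>
    obtain ⟨c, rfl⟩ := hD
    refine ⟨algebraMap ℂ K z • c, ?_⟩
    rw [Finsupp.sum_smul_index' hz, Finsupp.smul_sum]
    refine Finsupp.sum_congr fun a _ => ?_
    refine LinearMap.ext fun ψ => ?_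
    ext1 n
    change z • (algebraMap K (Phi g) (S.hat h (c a) n) * _) =
      algebraMap K (Phi g) (S.hat h (algebraMap ℂ K z * c a) n) * _
    rw [hat_mul, Pi.mul_apply, map_mul, hat_apply, hat_apply, AlgHom.commutes, Algebra.smul_def,
      ← IsScalarTower.algebraMap_apply ℂ K (Phi g), mul_assoc]

/-- The letter with index `0` acts trivially on functions, so words of length `k` in the `g + 1`
operators are the shifts of order at most `k`, made homogeneous with the help of `f`. -/
theorem Theta_opPow {x : ℂ} (hx : S.Good x) (H : MvPolynomial (Coord g) K) {k : ℕ}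
    {b : Fin (g + 1) →₀ ℕ} (hb : b.degree = k) :
    S.Theta x (k + 1) (S.opPow x b H) = shiftBy b.tail (S.Theta x 1 H) := by
  induction k generalizing b with
  | zero =>
    rw [Finsupp.degree_eq_zero_iff] at hb
    subst hb
    rw [opPow_zero, show (0 : Fin (g + 1) →₀ ℕ).tail = 0 from by ext; simp [Finsupp.tail_apply], shiftBy_zero]
  | succ k ih =>
    obtain ⟨i, b, rfl, hb'⟩ := exists_eq_add_single hb
    rw [← op_opPow]
    refine Fin.cases ?_ (fun i => ?_) i
    · rw [Theta_op_zero, ih hb']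
      congr 2
      ext j
      simp [Finsupp.tail_apply]
    · rw [← S.shift_Theta hx, ih hb', shift_shiftBy]
      congr 2
      ext j
      simp [Finsupp.tail_apply, Finsupp.single_apply]

theorem Theta_apply_zero (x : ℂ) (k : ℕ) (H : MvPolynomial (Coord g) K) :
    S.Theta x k H 0 = (algebraMap (MvPolynomial (Coord g) K) (Phi g)
      (map (algebraMap ℂ K) S.f) ^ k)⁻¹ * algebraMap _ _ H := by
  rw [Theta, expo_zero, map_expScale_zero, expr]
  simp [div_eq_inv_mul]

theorem linearIndependent_shiftBy {x : ℂ} (hx : S.Good x) {β : Fin g → MvPolynomial (Coord g) K}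
    (hβ : Submodule.span K (Set.range β) = S.W S.lam 1) :
    LinearIndependent K (fun p : (Fin g →₀ ℕ) × Fin g => shiftBy p.1 (S.Theta x 1 (β p.2)) 0) := by
  rw [linearIndependent_iff']
  intro s c hc
  -- All shifts in the relation are padded by powers of the index-`0` operator to the common length
  -- `k`, where `linearIndependent_opPow` applies.
  let k := s.sup fun p => p.1.degree
  have hk : ∀ p ∈ s, (Finsupp.cons (k - p.1.degree) p.1).degree = k := by
    intro p hp
    have : p.1.degree ≤ k := Finset.le_sup (f := fun p : (Fin g →₀ ℕ) × Fin g => p.1.degree) hp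
    rw [Finsupp.degree_eq_sum, Fin.sum_univ_succ]
    simp only [Finsupp.cons_zero, Finsupp.cons_succ]
    rw [← Finsupp.degree_eq_sum]
    omega
  let ι : s → {a : Fin (g + 1) →₀ ℕ // a.degree = k} × Fin g := fun p => (⟨_, hk p.1 p.2⟩, p.1.2)
  have hι : Function.Injective ι := by
    intro p q h
    have h1 := congrArg (fun y => Finsupp.tail y.1.1) h
    have h2 := congrArg Prod.snd h
    simp only [ι, Finsupp.tail_cons] at h1 h2
    exact Subtype.ext (Prod.ext h1 h2)
  have hli := (S.linearIndependent_opPow hx hβ k).comp ι hι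
  have hsum : ∑ p : s, c p • S.opPow x (Finsupp.cons (k - p.1.1.degree) p.1.1) (β p.1.2) = 0 := by
    apply IsFractionRing.injective (MvPolynomial (Coord g) K) (Phi g)
    have hne := inv_ne_zero (pow_ne_zero (k + 1) S.algebraMap_f_ne)
    apply mul_left_cancel₀ hne
    rw [map_zero, mul_zero, ← hc, ← Finset.sum_coe_sort s, map_sum, Finset.mul_sum]
    refine Finset.sum_congr rfl fun p _ => ?_
    have h1 := S.Theta_opPow hx (β p.1.2) (hk p.1 p.2)
    rw [Finsupp.tail_cons] at h1
    rw [← h1, Theta_apply_zero, smul_eq_C_mul, map_mul, Algebra.smul_def,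
      IsScalarTower.algebraMap_apply K (MvPolynomial (Coord g) K) (Phi g)]
    exact mul_left_comm _ _ _
  intro p hp
  exact Fintype.linearIndependent_iff.mp hli (fun p => c p) hsum ⟨p, hp⟩

/-- Evaluate the relation at `n = 0`: there the coefficient `r̂` becomes `r`, and independence over
`K` of the shifted values forces every `r` to vanish. -/
theorem linearIndependent_Theta {x : ℂ} (hx : S.Good x) {β : Fin g → MvPolynomial (Coord g) K}
    (hβ : Submodule.span K (Set.range β) = S.W S.lam 1) :
    LinearIndependent (S.T (S.steps x)) (fun j => S.Theta x 1 (β j)) := by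
  classical
  refine (Fintype.linearIndependent_iff (R := S.T (S.steps x))
    (v := fun j => S.Theta x 1 (β j))).mpr ?_
  intro D hD
  choose c hc using fun j => S.exists_finsupp_of_mem_T (D j).2
  let U : Finset (Fin g →₀ ℕ) := Finset.univ.biUnion fun j => (c j).support
  have hU : ∀ j, (c j).support ⊆ U := fun j =>
    Finset.subset_biUnion_of_mem (fun j => (c j).support) (Finset.mem_univ j)
  have hsum : ∑ p ∈ U ×ˢ Finset.univ, c p.2 p.1 • shiftBy p.1 (S.Theta x 1 (β p.2)) 0 = 0 := by
    rw [Finset.sum_product_right]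
    have h0 := congrFun hD 0
    rw [Finset.sum_apply, Pi.zero_apply] at h0
    rw [← h0]
    refine Finset.sum_congr rfl fun j _ => ?_
    have h1 : (D j • S.Theta x 1 (β j)) 0 =
        ((c j).sum fun a r => mulOp (S.hat (S.steps x) r) * shiftBy a) (S.Theta x 1 (β j)) 0 := by
      rw [← hc]
      rfl
    rw [h1, Finsupp.sum, LinearMap.sum_apply, Finset.sum_apply]
    symm
    rw [Finset.sum_subset (hU j)]
    · refine Finset.sum_congr rfl fun a _ => ?_
      rw [Module.End.mul_apply, mulOp_apply, hat_apply, expo_zero, expScale_zero, AlgHom.id_apply,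
        Algebra.smul_def]
    · intro a _ ha
      rw [Finsupp.notMem_support_iff.mp ha, Module.End.mul_apply, mulOp_apply, hat_apply, map_zero,
        map_zero, zero_mul]
  have hz := linearIndependent_iff'.mp (S.linearIndependent_shiftBy hx hβ) (U ×ˢ Finset.univ)
    (fun p => c p.2 p.1) hsum
  intro j
  have hcj : c j = 0 := by
    ext a
    by_cases ha : a ∈ (c j).support
    · exact hz (a, j) (Finset.mem_product.mpr ⟨hU j ha, Finset.mem_univ _⟩)
    · exact Finsupp.notMem_support_iff.mp ha
  apply Subtype.ext
  rw [hc j, hcj, Finsupp.sum_zero_index]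
  rfl

theorem exists_isFreeBasis (hg : 1 ≤ g) {x : ℂ} (hx : S.Good x) :
    ∃ Ψ : Fin g → DFun g, S.IsFreeBasis (S.steps x) Ψ := by
  obtain ⟨β, hβ⟩ := S.exists_basis_W_one
  exact ⟨fun j => S.Theta x 1 (β j),
    fun j => (S.mem_Mhat_iff hg hx).mpr ⟨β j, hβ ▸ Submodule.subset_span ⟨j, rfl⟩, rfl⟩,
    S.linearIndependent_Theta hx hβ, S.span_eq_iUnion_Mhat hg hx hβ⟩

/-- Together with `0`, the good parameters form a neighbourhood of `0`, which has the cardinality of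
the continuum. -/
theorem not_countable_good : ¬ {x : ℂ | S.Good x}.Countable := by
  intro h
  have h1 : (insert 0 {x : ℂ | S.Good x}) ∈ 𝓝 (0 : ℂ) := by
    have := S.eventually_good
    rw [eventually_nhdsWithin_iff] at this
    filter_upwards [this] with x hx
    by_cases h0 : x = 0
    · exact Or.inl h0
    · exact Or.inr (hx h0)
  have h2 := cardinal_eq_of_mem_nhds ℂ h1
  have h3 : Cardinal.mk (insert 0 {x : ℂ | S.Good x} : Set ℂ) ≤ Cardinal.aleph0 :=
    Cardinal.mk_le_aleph0_iff.mpr (h.insert 0).to_subtype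
  rw [h2, Cardinal.mk_complex] at h3
  exact absurd h3 (not_le.mpr Cardinal.aleph0_lt_continuum)

end Data
end RationalDBA
end

theorem mainTheorem5 {g : ℕ} (hg : 1 ≤ g) (S : RationalDBA.Data g) :
    ¬ {h : Fin g → ℂ | (∀ i, h i ≠ 0) ∧
        ∃ Ψ : Fin g → RationalDBA.DFun g, S.IsFreeBasis h Ψ}.Countable ∧
    ∀ h : Fin g → ℂ, (∀ i, h i ≠ 0) →
      ∀ Ψ : Fin g → RationalDBA.DFun g, S.IsFreeBasis h Ψ →
        ∃ D : S.merRing →ₐ[ℂ] Matrix (Fin g) (Fin g) (S.T h),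
          Function.Injective D ∧
          ∀ (φ : S.merRing) (i : Fin g),
            ∑ j, D φ i j • Ψ j =
              fun n => RationalDBA.toPhi g (φ : FractionRing _) * Ψ i n := by
  -- The map `x ↦ (x / c̃ᵢ)` is injective because `g ≥ 1`, so countably many `h` would leave only
  -- countably many good `x`.
  refine ⟨fun hc => S.not_countable_good ?_, fun h _ Ψ hΨ => S.exists_algHom hg h Ψ hΨ⟩
  refine Set.Countable.mono (fun x (hx : S.Good x) => ?_)
    (hc.preimage_of_injOn (f := S.steps) ?_)
  · exact ⟨fun i => div_ne_zero hx.ne_zero (S.c_ne i), S.exists_isFreeBasis hg hx⟩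
  intro x _ y _ hxy
  have := congrFun hxy ⟨0, hg⟩
  exact (div_left_inj' (S.c_ne _)).mp this
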